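/- Let $\mathbb B^2$ be the open unit ball of $\mathbb C^2$ (Euclidean norm), $\partial\mathbb B^2$ the unit sphere. A complex affine function is $f(z)=f_0+f_1z_1+f_2z_2$ with $f_0,f_1,f_2\in\mathbb C$; its gradient has norm $|\nabla f|=(|f_1|^2+|f_2|^2)^{1/2}$. For such $f$ with $|\nabla f|=1$, and $\sigma,r>0$, put $$T_f(\sigma)=\{z\in\partial\mathbb B^2:|f(z)|\le\sigma\},\qquad {}^rT_f(\sigma)=\{z\in r\,\partial\mathbb B^2:|f(z)|\le\sigma\},$$ and for $s\in(0,1)$ put $T^s(\sigma)=\{z\in\partial\mathbb B^2:|z_1-(1-s)|\le\sigma\}$. A solid torus is a set homeomorphic to the product of a closed disc and a circle. Two subsets of $\mathbb C^2$ are unitarily equivalent if a unitary map of $\mathbb C^2$ carries one onto the other. The polynomial hull of a compact set $K\subset\mathbb C^2$ is $\widehat K=\{z\in\mathbb C^2:|p(z)|\le\max_K|p|\text{ for all polynomials }p\}$. **Proposition 4.** Let $s\in(0,1)$. There exists a constant $\sigma'=\sigma'(s)>0$ such that for every $\sigma\in(0,\sigma')$ there exist a number $\rho=\rho(s,\sigma)\in(0,1)$,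 a finite set $\{s_m\}=\{s_m(s,\sigma)\}\subset(0,1)$, a number $\varepsilon'=\varepsilon'(s,\sigma,\{s_m\})>0$ and a number $r'=r'(s,\sigma,\{s_m\})\in(0,1)$, where for fixed $s$, as $\sigma\to0$, $$\rho(s,\sigma)\to0\quad\text{and}\quad \max_m s_m(s,\sigma)\to0,$$ with the following property. For every $\varepsilon\in(0,\varepsilon')$ there exist finitely many complex affine functions $f_n$ with $|\nabla f_n|=1$ such that, writing $T_n=T_{f_n}$ and ${}^rT_n={}^rT_{f_n}$, 1. the sets $T_n(2\varepsilon)$ are pairwise disjoint solid tori, each of them unitarily equivalent to $T^{s_m}(2\varepsilon)$ for some $m$; 2. each $T_n(2\varepsilon)$ is contained in $\{|z_1-(1-s)|\le2\sigma\}$; 3. $\displaystyle (1-\rho)\overline{\mathbb B^2}\cap\{|z_1-(1-s)|\le\sigma\}\subset\widehat{\Big(\bigcup_nT_n(\varepsilon)\Big)}$; 4. for every $r\in[r',1]$, $\displaystyle (1-\rho)\overline{\mathbb B^2}\cap\{|z_1-(1-s)|\le\sigma\}\subset\widehat{\Big(\bigcup_n{}^rT_n(\varepsilon)\Big)}$.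 -/

import Mathlib

open Filter Topology

/-- The space `ℂ²` with its Euclidean (Hermitian) norm. Coordinates `z 0`, `z 1` are `z₁`, `z₂`. -/
abbrev C2 : Type := EuclideanSpace ℂ (Fin 2)

/-- The polynomial hull of a set `K ⊆ ℂ²`: the points `z` such that for every polynomial `p`,
`|p z|` does not exceed any bound for `|p|` on `K`. For compact `K ≠ ∅` this says
`|p z| ≤ max_K |p|`; the hull of the empty set is empty. -/
def polynomialHull (K : Set C2) : Set C2 :=
  {z | ∀ (p : MvPolynomial (Fin 2) ℂ) (M : ℝ),
    (∀ w ∈ K, ‖MvPolynomial.eval (fun i => w i) p‖ ≤ M) →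
      ‖MvPolynomial.eval (fun i => z i) p‖ ≤ M}

/-- Complex affine functions `f(z) = f₀ + f₁ z₁ + f₂ z₂` with `|∇f| = 1`. -/
def IsUnitAffine (f : C2 → ℂ) : Prop :=
  ∃ f₀ f₁ f₂ : ℂ, ‖f₁‖ ^ 2 + ‖f₂‖ ^ 2 = 1 ∧ ∀ z : C2, f z = f₀ + f₁ * z 0 + f₂ * z 1

/-- `T_f(σ) = {z ∈ ∂𝔹² : |f z| ≤ σ}`. -/
def torus (f : C2 → ℂ) (σ : ℝ) : Set C2 :=
  {z | z ∈ Metric.sphere (0 : C2) 1 ∧ ‖f z‖ ≤ σ}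

/-- `ʳT_f(σ) = {z ∈ r ∂𝔹² : |f z| ≤ σ}`. -/
def radiusTorus (r : ℝ) (f : C2 → ℂ) (σ : ℝ) : Set C2 :=
  {z | z ∈ Metric.sphere (0 : C2) r ∧ ‖f z‖ ≤ σ}

/-- `Tˢ(σ) = {z ∈ ∂𝔹² : |z₁ - (1 - s)| ≤ σ}`. -/
def standardTorus (s σ : ℝ) : Set C2 :=
  torus (fun z => z 0 - (1 - (s : ℂ))) σ

/-- The closed tube `{z ∈ ℂ² : |z₁ - (1 - s)| ≤ δ}` around the complex line `z₁ = 1 - s`. -/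
def lineTube (s δ : ℝ) : Set C2 :=
  {z | ‖z 0 - (1 - (s : ℂ))‖ ≤ δ}

/-- Two subsets of `ℂ²` are unitarily equivalent if a unitary map of `ℂ²` carries one onto the
other. -/
def UnitarilyEquivalent (A B : Set C2) : Prop :=
  ∃ U : C2 ≃ₗᵢ[ℂ] C2, U '' A = B

/-- A (closed) solid torus: a set homeomorphic to the product of a closed disc and a circle. -/
def IsSolidTorus (A : Set C2) : Prop :=
  Nonempty (A ≃ₜ (Metric.closedBall (0 : ℂ) 1) × Circle)

/-! All lines used have the same distance `d = 1 - t` to the origin, with `t = σ² / 32`, so a single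
`s_m = t` suffices. Take a fine net on the part of the sphere of radius `R = 1 - t / 2` inside the
tube. Through each net point `R u` pass `K` such lines, `⟪a u + b wⁿ v, z⟫ = d` with `a R = d` and
`w` a primitive `K`-th root of unity.

Hull: in frame coordinates `x, y` the product of the defining functions is `(d - a x)^K - (b y)^K`.
A point `q` near `R u` lies on a level curve of this product with level at most `2 (c / 4)^K`. On
the sphere of radius `r` one of the two bases has modulus at least `c`, so their quotient is close
to a root of unity, and the curve meets the sphere inside the `ε`-tubes once `2^K ≥ 4 / ε`. The
maximum principle on the curve puts `q` into the hull (`mem_polynomialHull_iUnion_radiusTorus`).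
Discs in the lines `z₁ = const` then fill in the ball.

Disjointness: lines of one family meet only at `R u`, inside the ball, and their circles are
separated quantitatively by order `1 / K²`. For different families, each net point is multiplied by
a small phase; a pair of lines excludes only few phases on a grid of mesh of order `√ε`
(`not_three_small_linkingGap`). Both arguments need `K² √ε` small, which `K ~ log (1 / ε)` allows.
-/

/-! ### Unitary coordinates. -/

/-- An orthonormal pair of vectors of `ℂ²`. -/
def IsFrame (u v : C2) : Prop := ‖u‖ = 1 ∧ ‖v‖ = 1 ∧ inner ℂ u v = 0

theorem IsFrame.exists_basis {u v : C2} (h : IsFrame u v) :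
    ∃ b : OrthonormalBasis (Fin 2) ℂ C2, b 0 = u ∧ b 1 = v := by
  obtain ⟨hu, hv, huv⟩ := h
  have hvu : inner ℂ v u = 0 := inner_eq_zero_symm.mp huv
  have ho : Orthonormal ℂ ((Set.univ : Set (Fin 2)).domRestrict ![u, v]) := by
    refine ⟨?_, ?_⟩
    · rintro ⟨i, -⟩
      fin_cases i
      · exact hu
      · exact hv
    · rintro ⟨i, -⟩ ⟨j, -⟩
      fin_cases i <;> fin_cases j <;> intro hij
      · exact absurd rfl hij
      · exact huv
      · exact hvu
      · exact absurd rfl hij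
  obtain ⟨b, hb⟩ := ho.exists_orthonormalBasis_extension_of_card_eq (by simp)
  exact ⟨b, by simpa using hb 0 trivial, by simpa using hb 1 trivial⟩

theorem exists_isFrame {u : C2} (hu : ‖u‖ = 1) : ∃ v, IsFrame u v := by
  have ho : Orthonormal ℂ (({0} : Set (Fin 2)).domRestrict fun _ => u) := by
    refine ⟨fun _ => hu, ?_⟩
    rintro ⟨i, hi⟩ ⟨j, hj⟩ hij
    exact absurd (Subtype.ext (hi.trans hj.symm)) hij
  obtain ⟨b, hb⟩ := ho.exists_orthonormalBasis_extension_of_card_eq (by simp)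
  have h0 : b 0 = u := hb 0 rfl
  refine ⟨b 1, hu, by simp, ?_⟩
  rw [← h0]
  exact b.orthonormal.2 (by decide)

theorem IsFrame.expand {u v : C2} (h : IsFrame u v) (z : C2) :
    z = inner ℂ u z • u + inner ℂ v z • v := by
  obtain ⟨b, rfl, rfl⟩ := h.exists_basis
  conv_lhs => rw [← b.sum_repr z]
  simp [Fin.sum_univ_two, b.repr_apply_apply]

theorem IsFrame.norm_sq {u v : C2} (h : IsFrame u v) (z : C2) :
    ‖z‖ ^ 2 = ‖inner ℂ u z‖ ^ 2 + ‖inner ℂ v z‖ ^ 2 := by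
  obtain ⟨b, rfl, rfl⟩ := h.exists_basis
  rw [← b.sum_sq_norm_inner_right z, Fin.sum_univ_two]

theorem IsFrame.inner_left {u v : C2} (h : IsFrame u v) (x y : ℂ) :
    inner ℂ u (x • u + y • v) = x := by
  simp [h.2.2, h.1]

theorem IsFrame.inner_right {u v : C2} (h : IsFrame u v) (x y : ℂ) :
    inner ℂ v (x • u + y • v) = y := by
  simp [inner_eq_zero_symm.mp h.2.2, h.2.1]

theorem IsFrame.norm_sq_add {u v : C2} (h : IsFrame u v) (x y : ℂ) :
    ‖x • u + y • v‖ ^ 2 = ‖x‖ ^ 2 + ‖y‖ ^ 2 := by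
  rw [h.norm_sq, h.inner_left, h.inner_right]

theorem IsFrame.smul {u v : C2} (h : IsFrame u v) {w : ℂ} (hw : ‖w‖ = 1) :
    IsFrame (w • u) (w • v) := by
  refine ⟨by simp [norm_smul, hw, h.1], by simp [norm_smul, hw, h.2.1], ?_⟩
  simp [h.2.2]

/-! ### Maximum principle on the curves `y ^ K = Y x`. -/

theorem sum_pow_of_isPrimitiveRoot {K : ℕ} {w : ℂ} (hw : IsPrimitiveRoot w K) (b : ℕ) :
    ∑ j ∈ Finset.range K, (w ^ j) ^ b = if K ∣ b then (K : ℂ) else 0 := by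
  simp_rw [← pow_mul, mul_comm _ b, pow_mul]
  split_ifs with h
  · rw [(hw.pow_eq_one_iff_dvd b).2 h]
    simp
  · have h1 : w ^ b ≠ 1 := fun h' => h ((hw.pow_eq_one_iff_dvd b).1 h')
    rw [geom_sum_eq h1, ← pow_mul, mul_comm, pow_mul, hw.pow_eq_one]
    simp

/-- The sum of a polynomial over the fibre of the curve `y ^ K = Y x` is a holomorphic function
of `x`. -/
theorem exists_differentiable_fibre_sum {K : ℕ} {w : ℂ} (hw : IsPrimitiveRoot w K) {Y : ℂ → ℂ}
    (hY : Differentiable ℂ Y) (P : Polynomial (Polynomial ℂ)) :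
    ∃ R : ℂ → ℂ, Differentiable ℂ R ∧ ∀ x y, y ^ K = Y x →
      ∑ j ∈ Finset.range K, P.evalEval x (w ^ j * y) = R x := by
  induction P using Polynomial.induction_on' with
  | add P Q hP hQ =>
    obtain ⟨R, hR, hR'⟩ := hP
    obtain ⟨T, hT, hT'⟩ := hQ
    refine ⟨fun x => R x + T x, hR.add hT, fun x y h => ?_⟩
    simp only [Polynomial.evalEval_add, Finset.sum_add_distrib, hR' x y h, hT' x y h]
  | monomial b q =>
    refine ⟨fun x => q.eval x * ((if K ∣ b then (K : ℂ) else 0) * Y x ^ (b / K)),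
      q.differentiable.mul ((differentiable_const _).mul (hY.pow _)), fun x y h => ?_⟩
    have : ∀ j, (Polynomial.monomial b q).evalEval x (w ^ j * y)
        = q.eval x * y ^ b * (w ^ j) ^ b := fun j => by
      simp [Polynomial.evalEval, mul_pow]
      ring
    simp_rw [this, ← Finset.mul_sum, sum_pow_of_isPrimitiveRoot hw]
    split_ifs with hb
    · rw [← h, ← pow_mul, Nat.mul_div_cancel' hb]
      ring
    · simp

/-- A polynomial on `ℂ²` in the coordinates of a frame. -/
theorem exists_bivariate (u v : C2) (p : MvPolynomial (Fin 2) ℂ) :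
    ∃ P : Polynomial (Polynomial ℂ), ∀ x y : ℂ,
      P.evalEval x y = MvPolynomial.eval (fun i => (x • u + y • v) i) p := by
  induction p using MvPolynomial.induction_on with
  | C c => exact ⟨Polynomial.C (Polynomial.C c), fun x y => by simp⟩
  | add p q hp hq =>
    obtain ⟨P, hP⟩ := hp
    obtain ⟨Q, hQ⟩ := hq
    exact ⟨P + Q, fun x y => by rw [Polynomial.evalEval_add, hP, hQ, map_add]⟩
  | mul_X p i hp =>
    obtain ⟨P, hP⟩ := hp
    refine ⟨P * (Polynomial.C (Polynomial.X * Polynomial.C (u i))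
      + Polynomial.X * Polynomial.C (Polynomial.C (v i))), fun x y => ?_⟩
    simp [Polynomial.evalEval_mul, hP, Polynomial.evalEval_add, Polynomial.evalEval_C]
    left
    ring

/-- Removes a constant factor from a maximum principle: apply it to all powers of a polynomial and
take `k`-th roots. -/
theorem le_of_forall_pow_le_mul {a M C : ℝ} (ha : 0 ≤ a) (h : ∀ k : ℕ, 1 ≤ k → a ^ k ≤ C * M ^ k)
    (hC : 0 < C) : a ≤ M := by
  have hM : 0 ≤ M := by
    have := h 1 le_rfl
    rw [pow_one, pow_one] at this
    by_contra hM
    nlinarith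
  by_contra! hlt
  rcases hM.eq_or_lt with rfl | hM
  · have := h 1 le_rfl
    simp at this
    linarith
  obtain ⟨k, hk⟩ := pow_unbounded_of_one_lt C ((one_lt_div hM).2 hlt)
  have h1 : C < (a / M) ^ (k + 1) :=
    hk.trans_le (pow_le_pow_right₀ ((one_lt_div hM).2 hlt).le (Nat.le_succ k))
  rw [div_pow, lt_div_iff₀ (by positivity)] at h1
  linarith [h (k + 1) (by omega)]

/-- The maximum principle on the part of the curve `y ^ K = Y x` in a ball, where `x, y` are the
coordinates with respect to a frame. -/
theorem mem_polynomialHull_of_pow_eq {u v : C2} (hf : IsFrame u v) {A : Set C2} {r : ℝ}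
    (hr : 0 ≤ r) {K : ℕ} (hK : 0 < K) {Y : ℂ → ℂ} (hY : Differentiable ℂ Y)
    (hA : ∀ z : C2, ‖z‖ = r → inner ℂ v z ^ K = Y (inner ℂ u z) → z ∈ A)
    {q : C2} (hq : ‖q‖ ≤ r) (hqY : inner ℂ v q ^ K = Y (inner ℂ u q)) :
    q ∈ polynomialHull A := by
  intro p M hM
  rcases hq.eq_or_lt with hq | hq
  · exact hM q (hA q hq hqY)
  set x₀ := inner ℂ u q with hx₀
  set y₀ := inner ℂ v q with hy₀
  obtain ⟨P, hP⟩ := exists_bivariate u v p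
  have hw := Complex.isPrimitiveRoot_exp K hK.ne'
  set w := Complex.exp (2 * Real.pi * Complex.I / K)
  -- a polynomial in `y` which singles out the point `q` of its fibre
  obtain ⟨g, hg⟩ : ∃ g : Polynomial (Polynomial ℂ), (∀ x x' y, g.evalEval x y = g.evalEval x' y) ∧
      ∀ Q : ℂ → ℂ, ∑ j ∈ Finset.range K, Q (w ^ j * y₀) * g.evalEval x₀ (w ^ j * y₀)
        = K * Q y₀ := by
    by_cases hy : y₀ = 0
    · exact ⟨1, by simp, fun Q => by simp [hy]⟩
    -- With `g = ∑ (y / y₀)^l`, the value at `w ^ j * y₀` is `K` for `j = 0` and zero otherwise. For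
    -- `y₀ = 0` the fibre is one repeated point and `g = 1` works.
    refine ⟨∑ l ∈ Finset.range K,
      Polynomial.C (Polynomial.C ((y₀⁻¹) ^ l)) * Polynomial.X ^ l, ?_, fun Q => ?_⟩
    · intro x x' y
      simp [Polynomial.evalEval_finsetSum, Polynomial.evalEval_mul, Polynomial.evalEval_pow]
    · have h1 : ∀ j, (∑ l ∈ Finset.range K, Polynomial.C (Polynomial.C ((y₀⁻¹) ^ l)) *
          Polynomial.X ^ l : Polynomial (Polynomial ℂ)).evalEval x₀ (w ^ j * y₀)
          = ∑ l ∈ Finset.range K, (w ^ l) ^ j := fun j => by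
        rw [Polynomial.evalEval_finsetSum]
        refine Finset.sum_congr rfl fun l _ => ?_
        rw [Polynomial.evalEval_mul, Polynomial.evalEval_pow, Polynomial.evalEval_X,
          Polynomial.evalEval_CC, mul_pow, ← pow_mul, ← pow_mul, mul_comm l j,
          mul_left_comm, ← mul_pow, inv_mul_cancel₀ hy, one_pow, mul_one]
      simp_rw [h1, sum_pow_of_isPrimitiveRoot hw]
      rw [Finset.sum_eq_single_of_mem 0 (Finset.mem_range.2 hK)]
      · simp [mul_comm]
      · intro j hj hj0
        rw [if_neg (fun h => hj0 (Nat.eq_zero_of_dvd_of_lt h (Finset.mem_range.1 hj))), mul_zero]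
  obtain ⟨hgx, hg⟩ := hg
  have hgc : Continuous fun y => g.evalEval x₀ y := by
    simp only [Polynomial.evalEval]
    have : (fun y : ℂ => Polynomial.eval x₀ (Polynomial.eval (Polynomial.C y) g))
        = fun y => (g.map (Polynomial.evalRingHom x₀)).eval y := by
      ext y
      rw [← Polynomial.evalEval, Polynomial.map_evalRingHom_eval]
    rw [this]
    exact Polynomial.continuous _
  obtain ⟨G, hG⟩ := (isCompact_closedBall (0 : ℂ) r).exists_bound_of_continuousOn hgc.continuousOn
  replace hG : ∀ y ∈ Metric.closedBall (0 : ℂ) r, ‖g.evalEval x₀ y‖ ≤ |G| + 1 := fun y hy =>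
    (hG y hy).trans ((le_abs_self G).trans (by linarith))
  have hG0 : 0 < |G| + 1 := by positivity
  generalize |G| + 1 = G' at hG hG0
  have hz : ∀ z : C2, MvPolynomial.eval (fun i => z i) p
      = P.evalEval (inner ℂ u z) (inner ℂ v z) := fun z => by
    rw [hP, ← hf.expand z]
  rw [hz q]
  refine le_of_forall_pow_le_mul (C := G') (norm_nonneg _) (fun k _ => ?_) hG0
  -- The fibre sum of `P ^ k * g` is entire in `x` and equals `K` times the `k`-th power of the
  -- value at `q` when `x = x₀`. The bound `G'` for `g` does not depend on `k`.
  obtain ⟨R, hR, hR'⟩ := exists_differentiable_fibre_sum hw hY (P ^ k * g)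
  have hK' : (0 : ℝ) < K := by exact_mod_cast hK
  -- All points of the curve over `x` have the same norm, whose square is `φ x`. Thus `U` is the
  -- projection of the part of the curve in the open ball, and the fibres over its frontier lie on
  -- the sphere.
  let φ : ℂ → ℝ := fun x => ‖x‖ ^ 2 + ‖Y x‖ ^ (2 / K : ℝ)
  have hφ : Continuous φ := by
    have := hY.continuous
    refine (continuous_norm.pow 2).add (this.norm.rpow_const fun _ => Or.inr (by positivity))
  have hfib : ∀ x y : ℂ, y ^ K = Y x → φ x = ‖x‖ ^ 2 + ‖y‖ ^ 2 := fun x y h => by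
    simp only [φ, ← h, norm_pow]
    rw [← Real.rpow_natCast ‖y‖ K, ← Real.rpow_mul (norm_nonneg _), mul_div_cancel₀ _ hK'.ne',
      Real.rpow_two]
  let U : Set ℂ := {x | φ x < r ^ 2}
  have hUb : Bornology.IsBounded U := by
    refine (Metric.isBounded_closedBall (x := (0 : ℂ)) (r := r)).subset fun x hx => ?_
    rw [mem_closedBall_zero_iff]
    have h1 : ‖x‖ ^ 2 + ‖Y x‖ ^ (2 / K : ℝ) < r ^ 2 := hx
    have h2 : 0 ≤ ‖Y x‖ ^ (2 / K : ℝ) := by positivity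
    exact le_of_sq_le_sq (by linarith) hr
  have hx₀U : x₀ ∈ U := by
    change φ x₀ < r ^ 2
    rw [hfib x₀ y₀ hqY, ← hf.norm_sq]
    exact pow_lt_pow_left₀ hq (norm_nonneg _) two_ne_zero
  have key : ‖R x₀‖ ≤ K * (M ^ k * G') := by
    refine Complex.norm_le_of_forall_mem_frontier_norm_le hUb hR.diffContOnCl (fun x hx => ?_)
      (subset_closure hx₀U)
    have hx' : φ x = r ^ 2 := frontier_lt_subset_eq hφ continuous_const hx
    obtain ⟨y, hy⟩ := IsAlgClosed.exists_pow_nat_eq (Y x) hK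
    rw [← hR' x y hy]
    refine (norm_sum_le _ _).trans ?_
    have : ∀ j ∈ Finset.range K, ‖(P ^ k * g).evalEval x (w ^ j * y)‖ ≤ M ^ k * G' := by
      intro j _
      have hj : (w ^ j * y) ^ K = Y x := by
        rw [mul_pow, ← pow_mul, mul_comm, pow_mul', hw.pow_eq_one, one_pow, mul_one, hy]
      have hn := hfib x _ hj
      rw [hx'] at hn
      have hzn : ‖x • u + (w ^ j * y) • v‖ = r := by
        rw [← sq_eq_sq₀ (norm_nonneg _) hr, hf.norm_sq_add, hn]
      rw [Polynomial.evalEval_mul, Polynomial.evalEval_pow, norm_mul, norm_pow, hP, hgx x x₀]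
      refine mul_le_mul (pow_le_pow_left₀ (norm_nonneg _) (hM _ (hA _ hzn ?_)) _) (hG _ ?_)
        (norm_nonneg _) (pow_nonneg ((norm_nonneg _).trans (hM _ (hA _ hzn ?_))) _)
      · rw [hf.inner_left, hf.inner_right, hj]
      · rw [mem_closedBall_zero_iff]
        exact le_of_sq_le_sq (by nlinarith [norm_nonneg x]) hr
      · rw [hf.inner_left, hf.inner_right, hj]
    exact (Finset.sum_le_sum this).trans (by simp)
  have hRx : R x₀ = K * (P.evalEval x₀ y₀) ^ k := by
    rw [← hR' x₀ y₀ hqY, ← hg fun y => P.evalEval x₀ y ^ k]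
    simp [Polynomial.evalEval_mul, Polynomial.evalEval_pow]
  rw [hRx, norm_mul, norm_pow, Complex.norm_natCast] at key
  rw [mul_comm G']
  exact le_of_mul_le_mul_left key hK'

/-! ### The hull of the tubes around one pencil of lines. -/

/-- The root `exp (log (x ^ K) / K)` of `x ^ K` is near `1`, and `x` differs from it by a factor
which is a `K`-th root of unity. -/
theorem exists_pow_near_of_norm_pow_sub_one_le {K : ℕ} (hK : 2 ≤ K) {w : ℂ}
    (hw : IsPrimitiveRoot w K) {x : ℂ} {δ : ℝ} (hδ : δ ≤ 1 / 2) (hx : ‖x ^ K - 1‖ ≤ δ) :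
    ∃ n < K, ‖x - w ^ n‖ ≤ 2 * δ := by
  have hK0 : K ≠ 0 := by omega
  have hKR : (2 : ℝ) ≤ K := by exact_mod_cast hK
  set s := x ^ K - 1 with hs
  have hxs : x ^ K = 1 + s := by rw [hs]; ring
  have h1s : 1 + s ≠ 0 := by
    intro h
    have : s = -1 := by linear_combination h
    rw [this, norm_neg, norm_one] at hx
    linarith
  set l := Complex.log (1 + s) / K with hl
  have hlog := Complex.norm_log_one_add_half_le_self (hx.trans hδ)
  have hln : ‖l‖ ≤ 3 / 4 * δ := by
    rw [hl, norm_div, Complex.norm_natCast, div_le_iff₀ (by positivity)]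
    nlinarith [norm_nonneg s]
  set y := Complex.exp l with hy
  have : NeZero K := ⟨hK0⟩
  have hyK : y ^ K = 1 + s := by
    rw [hy, ← Complex.exp_nat_mul, hl, mul_div_cancel₀ _ (by exact_mod_cast hK0),
      Complex.exp_log h1s]
  have hy0 : y ≠ 0 := Complex.exp_ne_zero _
  have hxy : (x / y) ^ K = 1 := by
    rw [div_pow, hyK, hxs, div_self h1s]
  obtain ⟨n, hn, hn'⟩ := (hw.eq_pow_of_pow_eq_one hxy)
  refine ⟨n, hn, ?_⟩
  have hx' : x - w ^ n = w ^ n * (y - 1) := by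
    rw [hn']
    field_simp
  have hw1 : ‖w‖ = 1 := hw.norm'_eq_one hK0
  have hδ0 : 0 ≤ δ := (norm_nonneg s).trans hx
  rw [hx', norm_mul, norm_pow, hw1, one_pow, one_mul]
  linarith [Complex.norm_exp_sub_one_le (x := l) (by linarith)]

/-- The affine function `z ↦ ⟪ζ, z⟫ - d`. -/
noncomputable def lineFun (d : ℝ) (ζ : C2) (z : C2) : ℂ := inner ℂ ζ z - d

/-- If `α ^ K - β ^ K` is small compared with `α` and `β`, then `α` is close to one of the
numbers `w ^ n * β`. -/
theorem exists_norm_sub_pow_mul_le {α β c₀ : ℂ} {c ε : ℝ} (hc : 0 < c) (hε : 0 < ε) (hε1 : ε ≤ 1)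
    {K : ℕ} (hK2 : 2 ≤ K) (hK : 4 / ε ≤ 2 ^ K) {w : ℂ} (hw : IsPrimitiveRoot w K)
    (hmax : c ≤ ‖α‖ ∨ c ≤ ‖β‖) (hc₀n : ‖c₀‖ ≤ 2 * (c / 4) ^ K) (hV : α ^ K - β ^ K = c₀)
    (hβ : ‖β‖ ≤ 1) : ∃ n < K, ‖α - w ^ n * β‖ ≤ ε := by
  have hpow4 : (4 : ℝ) ^ K = 2 ^ K * 2 ^ K := by rw [← mul_pow]; norm_num
  have h2K : (4 : ℝ) ≤ 2 ^ K := by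
    calc (4 : ℝ) = 2 ^ 2 := by norm_num
      _ ≤ 2 ^ K := pow_le_pow_right₀ (by norm_num) hK2
  have hcK : 0 < c ^ K := by positivity
  -- If `β` were small, `α` would carry the lower bound `c`, but then `c ^ K ≤ (2 / 16 + 1 / 4) * c
  -- ^ K`.
  have hB : c / 2 < ‖β‖ := by
    by_contra! hB
    have hAx : c ≤ ‖α‖ := hmax.resolve_right (by linarith)
    have h1 : α ^ K = c₀ + β ^ K := by rw [← hV]; ring
    have h2 : ‖α‖ ^ K ≤ 2 * (c / 4) ^ K + (c / 2) ^ K := by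
      rw [← norm_pow, h1]
      refine (norm_add_le _ _).trans (add_le_add hc₀n ?_)
      rw [norm_pow]
      exact pow_le_pow_left₀ (norm_nonneg _) hB _
    have h3 : c ^ K ≤ ‖α‖ ^ K := pow_le_pow_left₀ hc.le hAx _
    rw [div_pow, div_pow, hpow4] at h2
    have h4 : c ^ K ≤ c ^ K * (3 / 8) := by
      have e1 : c ^ K / 2 ^ K ≤ c ^ K / 4 := by gcongr
      have e2 : c ^ K / (2 ^ K * 2 ^ K) ≤ c ^ K / (4 * 4) := by gcongr
      linarith
    linarith
  have hB0 : β ≠ 0 := norm_pos_iff.1 (by linarith [half_pos hc])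
  -- The relative error is at most `2 (c / 4)^K / (c / 2)^K = 2 / 2^K`.
  have hδ : ‖(α / β) ^ K - 1‖ ≤ ε / 2 := by
    have h1 : (α / β) ^ K - 1 = c₀ / β ^ K := by
      rw [← hV, div_pow]
      field_simp
    rw [h1, norm_div, norm_pow, div_le_iff₀ (by positivity)]
    have h2 : (c / 2) ^ K ≤ ‖β‖ ^ K := pow_le_pow_left₀ (by positivity) hB.le _
    have h3 : 4 ≤ 2 ^ K * ε := by rwa [div_le_iff₀ hε] at hK
    have h4 : 2 * (c / 4) ^ K ≤ ε / 2 * (c / 2) ^ K := by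
      rw [div_pow, div_pow, hpow4]
      rw [mul_div_assoc', mul_div_assoc', div_le_div_iff₀ (by positivity) (by positivity)]
      have : 0 ≤ c ^ K * 2 ^ K := by positivity
      nlinarith
    calc ‖c₀‖ ≤ _ := hc₀n
      _ ≤ _ := h4
      _ ≤ _ := by gcongr
  obtain ⟨n, hn, hn'⟩ := exists_pow_near_of_norm_pow_sub_one_le hK2 hw (by linarith) hδ
  refine ⟨n, hn, ?_⟩
  have h1 : α - w ^ n * β = (α / β - w ^ n) * β := by
    rw [sub_mul, div_mul_cancel₀ _ hB0]
  rw [h1, norm_mul]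
  nlinarith [norm_nonneg (α / β - w ^ n), norm_nonneg β]

/-- The hull of the tubes around `K` lines through the interior point `(d / a) • u`, evenly
distributed among the lines through this point with distance `d` to the origin, contains a
neighbourhood of this point, which does not depend on the radius `ε` of the tubes if `K` is at least
of the order of `log (1 / ε)`. -/
theorem mem_polynomialHull_iUnion_radiusTorus {u v : C2} (hf : IsFrame u v) {a b c d r ε : ℝ}
    (ha : 0 < a) (hb : 0 < b) (hab : a ^ 2 + b ^ 2 = 1) (hc : 0 < c)
    (hr : r ≤ 1) (hcr : c / a + c / b < r - d / a) (hd : 0 < d)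
    (hε : 0 < ε) (hε1 : ε ≤ 1) {K : ℕ} (hK : 4 / ε ≤ 2 ^ K) {w : ℂ} (hw : IsPrimitiveRoot w K)
    {q : C2} (hqr : ‖q‖ ≤ r) (hq : ‖q - ((d / a : ℝ) : ℂ) • u‖ ≤ c / 4) :
    q ∈ polynomialHull (⋃ n : Fin K,
      radiusTorus r (lineFun d ((a : ℂ) • u + ((b : ℂ) * w ^ (n : ℕ)) • v)) ε) := by
  have hr0 : 0 < r := by
    have : 0 < c / a + c / b + d / a := by positivity
    linarith
  have hK2 : 2 ≤ K := by
    by_contra! h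
    have h1 : (2 : ℝ) ^ K ≤ 2 ^ 1 := pow_le_pow_right₀ (by norm_num) (by omega)
    have h2 : 4 ≤ 4 / ε := by rw [le_div_iff₀ hε]; linarith
    linarith
  have hK0 : K ≠ 0 := by omega
  have hbC : (b : ℂ) ≠ 0 := by exact_mod_cast hb.ne'
  have haC : (a : ℂ) ≠ 0 := by exact_mod_cast ha.ne'
  have ha1 : a ≤ 1 := by nlinarith
  have hb1 : b ≤ 1 := by nlinarith
  set A : ℂ → ℂ := fun x => d - a * x with hA
  -- The level for which the curve passes through `q`.
  set c₀ := A (inner ℂ u q) ^ K - (b * inner ℂ v q) ^ K with hc₀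
  refine mem_polynomialHull_of_pow_eq hf hr0.le (K := K) (by omega)
    (Y := fun x => (A x ^ K - c₀) / (b : ℂ) ^ K) ?_ ?_ hqr ?_
  · simp only [hA]
    fun_prop
  · intro z hzr hz
    set x := inner ℂ u z
    set y := inner ℂ v z
    have hV : A x ^ K - (b * y) ^ K = c₀ := by
      rw [mul_pow, hz, mul_div_cancel₀ _ (pow_ne_zero _ hbC)]
      ring
    have hc₀n : ‖c₀‖ ≤ 2 * (c / 4) ^ K := by
      have hsq := hf.norm_sq (q - ((d / a : ℝ) : ℂ) • u)
      have e1 : inner ℂ u (q - ((d / a : ℝ) : ℂ) • u) = inner ℂ u q - (d / a : ℝ) := by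
        simp [hf.1]
      have e2 : inner ℂ v (q - ((d / a : ℝ) : ℂ) • u) = inner ℂ v q := by
        simp [inner_eq_zero_symm.mp hf.2.2]
      rw [e1, e2] at hsq
      have hq2 : ‖q - ((d / a : ℝ) : ℂ) • u‖ ^ 2 ≤ (c / 4) ^ 2 :=
        pow_le_pow_left₀ (norm_nonneg _) hq 2
      have h1 : ‖inner ℂ u q - (d / a : ℝ)‖ ≤ c / 4 :=
        le_of_sq_le_sq (by nlinarith [norm_nonneg (inner ℂ v q)]) (by positivity)
      have h2 : ‖inner ℂ v q‖ ≤ c / 4 :=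
        le_of_sq_le_sq (by nlinarith [norm_nonneg (inner ℂ u q - (d / a : ℝ))]) (by positivity)
      have h3 : A (inner ℂ u q) = - a * (inner ℂ u q - (d / a : ℝ)) := by
        simp only [hA]
        push_cast
        field_simp
        ring
      have h4 : ‖A (inner ℂ u q)‖ ≤ c / 4 := by
        rw [h3, norm_mul, norm_neg, Complex.norm_real, Real.norm_of_nonneg ha.le]
        nlinarith [norm_nonneg (inner ℂ u q - (d / a : ℝ))]
      have h5 : ‖b * inner ℂ v q‖ ≤ c / 4 := by
        rw [norm_mul, Complex.norm_real, Real.norm_of_nonneg hb.le]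
        nlinarith [norm_nonneg (inner ℂ v q)]
      rw [hc₀]
      refine (norm_sub_le _ _).trans ?_
      rw [norm_pow, norm_pow, two_mul]
      exact add_le_add (pow_le_pow_left₀ (norm_nonneg _) h4 _)
        (pow_le_pow_left₀ (norm_nonneg _) h5 _)
    have hxy : ‖x‖ ^ 2 + ‖y‖ ^ 2 = r ^ 2 := by rw [← hf.norm_sq, hzr]
    -- Otherwise the point is so close to the centre of the pencil that `‖x‖ + ‖y‖ < r`,
    -- contradicting `‖x‖² + ‖y‖² = r²`.
    have hmax : c ≤ ‖A x‖ ∨ c ≤ ‖b * y‖ := by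
      by_contra! h
      obtain ⟨h1, h2⟩ := h
      rw [norm_mul, Complex.norm_real, Real.norm_of_nonneg hb.le, mul_comm,
        ← lt_div_iff₀ hb] at h2
      have h3 : ‖x‖ < d / a + c / a := by
        have : (a : ℂ) * x = d - A x := by simp only [hA]; ring
        have h4 := congrArg norm this
        rw [norm_mul, Complex.norm_real, Real.norm_of_nonneg ha.le] at h4
        have h5 := norm_sub_le (d : ℂ) (A x)
        rw [Complex.norm_real, Real.norm_of_nonneg hd.le] at h5
        rw [← add_div, lt_div_iff₀ ha, mul_comm]
        linarith
      have h4 : ‖x‖ + ‖y‖ < r := by linarith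
      nlinarith [norm_nonneg x, norm_nonneg y]
    have hy1 : ‖y‖ ≤ 1 := by nlinarith [norm_nonneg y, norm_nonneg x]
    have hby : ‖b * y‖ ≤ 1 := by
      rw [norm_mul, Complex.norm_real, Real.norm_of_nonneg hb.le]
      nlinarith [norm_nonneg y]
    obtain ⟨n, hn, hn'⟩ := exists_norm_sub_pow_mul_le hc hε hε1 hK2 hK hw hmax hc₀n hV hby
    -- the index of the conjugate root of unity
    have : NeZero K := ⟨hK0⟩
    obtain ⟨m, hm, hm'⟩ : ∃ m < K, w ^ m = star (w ^ n) := by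
      obtain ⟨m, hm, h⟩ := hw.eq_pow_of_pow_eq_one (ξ := star (w ^ n)) (by
        rw [← star_pow, ← pow_mul, mul_comm, pow_mul, hw.pow_eq_one, one_pow, star_one])
      exact ⟨m, hm, h⟩
    refine Set.mem_iUnion.2 ⟨⟨m, hm⟩, mem_sphere_zero_iff_norm.2 hzr, ?_⟩
    have h1 : lineFun d ((a : ℂ) • u + ((b : ℂ) * w ^ m) • v) z
        = -(A x - w ^ n * (b * y)) := by
      rw [lineFun, inner_add_left, inner_smul_left, inner_smul_left, map_mul, Complex.conj_ofReal,
        Complex.conj_ofReal, hm', ← starRingEnd_apply, Complex.conj_conj]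
      simp only [hA, x, y]
      ring
    change ‖lineFun d ((a : ℂ) • u + ((b : ℂ) * w ^ m) • v) z‖ ≤ ε
    rw [h1, norm_neg]
    exact hn'
  · rw [hc₀, mul_pow]
    field_simp
    ring

/-! ### The sets cut out by tubes around lines are solid tori. -/

theorem isUnitAffine_lineFun {ζ : C2} (hζ : ‖ζ‖ = 1) (d : ℝ) : IsUnitAffine (lineFun d ζ) := by
  refine ⟨-d, star (ζ 0), star (ζ 1), ?_, fun z => ?_⟩
  · have := EuclideanSpace.norm_sq_eq ζ
    rw [hζ, Fin.sum_univ_two] at this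
    simpa using this.symm
  · simp only [lineFun, PiLp.inner_apply, Fin.sum_univ_two, RCLike.inner_apply,
      starRingEnd_apply]
    ring

/-- Every line at distance `1 - t` to the origin is mapped by a unitary map to `z₁ = 1 - t`. -/
theorem exists_image_torus_lineFun {ζ : C2} (hζ : ‖ζ‖ = 1) (t δ : ℝ) :
    ∃ U : C2 ≃ₗᵢ[ℂ] C2, U '' torus (lineFun (1 - t) ζ) δ = standardTorus t δ := by
  obtain ⟨v, hv⟩ := exists_isFrame hζ
  obtain ⟨b, hb, -⟩ := hv.exists_basis
  have h : ∀ z, b.repr z 0 = inner ℂ ζ z := fun z => by rw [b.repr_apply_apply, hb]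
  refine ⟨b.repr, ?_⟩
  ext z
  rw [LinearIsometryEquiv.image_eq_preimage_symm]
  have h' : inner ℂ ζ (b.repr.symm z) = z 0 := by rw [← h, LinearIsometryEquiv.apply_symm_apply]
  simp only [Set.mem_preimage, torus, standardTorus, Set.mem_ofPred_eq, mem_sphere_zero_iff_norm,
    LinearIsometryEquiv.norm_map, lineFun, h']
  push_cast
  rfl

theorem mem_standardTorus {t δ : ℝ} {z : C2} :
    z ∈ standardTorus t δ ↔ ‖z 0‖ ^ 2 + ‖z 1‖ ^ 2 = 1 ∧ ‖z 0 - (1 - t)‖ ≤ δ := by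
  have := EuclideanSpace.norm_sq_eq z
  rw [Fin.sum_univ_two] at this
  rw [standardTorus, torus, Set.mem_ofPred_eq, mem_sphere_zero_iff_norm, ← this,
    pow_eq_one_iff_of_nonneg (norm_nonneg z) two_ne_zero]

/-- Since `δ < t`, the disc of admissible `z₁` lies in the open unit disc, so `z₂ ≠ 0` and its
argument gives the circle factor. -/
theorem isSolidTorus_standardTorus {t δ : ℝ} (ht : t ≤ 1) (hδ : 0 < δ) (hδt : δ < t) :
    IsSolidTorus (standardTorus t δ) := by
  have hδC : (δ : ℂ) ≠ 0 := by exact_mod_cast hδ.ne'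
  have hlt : ∀ x : ℂ, ‖x - (1 - t)‖ ≤ δ → 0 < 1 - ‖x‖ ^ 2 := fun x hx => by
    have h1 := norm_add_le (x - (1 - t)) (1 - t : ℂ)
    have h2 : ‖(1 - t : ℂ)‖ = 1 - t := by
      rw [← Complex.ofReal_one, ← Complex.ofReal_sub, Complex.norm_real, Real.norm_of_nonneg]
      linarith
    rw [sub_add_cancel, h2] at h1
    nlinarith [norm_nonneg x]
  have hball : ∀ w : ℂ, w ∈ Metric.closedBall (0 : ℂ) 1 → ‖(1 - t + δ * w) - (1 - t)‖ ≤ δ :=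
    fun w hw => by
      rw [add_sub_cancel_left, norm_mul, Complex.norm_real, Real.norm_of_nonneg hδ.le]
      have := mem_closedBall_zero_iff.1 hw
      nlinarith
  have hne : ∀ z ∈ standardTorus t δ, z 1 ≠ 0 := fun z hz h => by
    obtain ⟨h1, h2⟩ := mem_standardTorus.1 hz
    have := hlt _ h2
    rw [h, norm_zero] at h1
    linarith
  let e : (Metric.closedBall (0 : ℂ) 1) × Circle ≃ standardTorus t δ :=
    { toFun := fun q => ⟨!₂[1 - t + δ * (q.1 : ℂ),
          (Real.sqrt (1 - ‖1 - t + δ * (q.1 : ℂ)‖ ^ 2) : ℂ) * (q.2 : ℂ)], by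
        rw [mem_standardTorus]
        refine ⟨?_, by simpa using hball _ q.1.2⟩
        have := hlt _ (hball _ q.1.2)
        have hq : ‖(q.2 : ℂ)‖ = 1 := Circle.norm_coe q.2
        simp [Real.sq_sqrt this.le, abs_of_nonneg (Real.sqrt_nonneg _), hq]⟩
      invFun := fun z => ⟨⟨(z.1 0 - (1 - t)) / δ, by
          rw [mem_closedBall_zero_iff, norm_div, Complex.norm_real, Real.norm_of_nonneg hδ.le,
            div_le_one hδ]
          exact (mem_standardTorus.1 z.2).2⟩,
        ⟨z.1 1 / ‖z.1 1‖, by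
          have := hne _ z.2
          simp [Submonoid.unitSphere, this]⟩⟩
      left_inv := fun q => by
        have := hlt _ (hball _ q.1.2)
        have hs := (Real.sqrt_pos.2 this).ne'
        have hs' := Real.sqrt_nonneg (1 - ‖1 - t + δ * (q.1 : ℂ)‖ ^ 2)
        have hq : ‖(q.2 : ℂ)‖ = 1 := Circle.norm_coe q.2
        ext
        · simp [hδC]
        · simp [abs_of_nonneg hs', hs, hq]
      right_inv := fun z => by
        obtain ⟨z, hz⟩ := z
        obtain ⟨h1, h2⟩ := mem_standardTorus.1 hz
        have hz0 : (1 - t + δ * ((z 0 - (1 - t)) / δ) : ℂ) = z 0 := by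
          field_simp
          ring
        have hz1 : Real.sqrt (1 - ‖z 0‖ ^ 2) = ‖z 1‖ := by
          rw [← h1, add_sub_cancel_left, Real.sqrt_sq (norm_nonneg _)]
        have hn : (‖z 1‖ : ℂ) ≠ 0 := by exact_mod_cast norm_ne_zero_iff.2 (hne z hz)
        ext i
        fin_cases i
        · exact hz0
        · change (Real.sqrt (1 - ‖(1 - t + δ * ((z 0 - (1 - t)) / δ) : ℂ)‖ ^ 2) : ℂ)
            * (z 1 / ‖z 1‖) = z 1
          rw [hz0, hz1, mul_div_cancel₀ _ hn] }
  have he : Continuous e := by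
    refine Continuous.subtype_mk ?_ _
    refine (PiLp.continuous_toLp 2 _).comp (continuous_pi fun i => ?_)
    fin_cases i
    · simp only [Fin.zero_eta, Matrix.cons_val_zero]
      fun_prop
    · simp only [Fin.mk_one, Matrix.cons_val_one]
      fun_prop
  -- A continuous bijection from a compact space to a Hausdorff space is a homeomorphism.
  have : CompactSpace (Metric.closedBall (0 : ℂ) 1) :=
    isCompact_iff_compactSpace.1 (isCompact_closedBall _ _)
  exact ⟨(he.homeoOfEquivCompactToT2).symm⟩

theorem isSolidTorus_torus_lineFun {ζ : C2} (hζ : ‖ζ‖ = 1) {t δ : ℝ} (ht : t ≤ 1) (hδ : 0 < δ)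
    (hδt : δ < t) : IsSolidTorus (torus (lineFun (1 - t) ζ) δ) := by
  obtain ⟨U, hU⟩ := exists_image_torus_lineFun hζ t δ
  obtain ⟨e⟩ := isSolidTorus_standardTorus ht hδ hδt
  rw [← hU] at e
  exact ⟨(U.toHomeomorph.image _).trans e⟩

/-! ### Disjointness of tori, measured by the linking gap. -/

/-- The circles cut out of the unit sphere by two lines `⟪ζ, z⟫ = d` and `⟪ξ, z⟫ = d` with unit
vectors `ζ ≠ ξ` meet if and only if this function vanishes at `⟪ζ, ξ⟫`. -/
noncomputable def linkingGap (d : ℝ) (c : ℂ) : ℝ := ‖c‖ ^ 2 - 2 * d ^ 2 * c.re + 2 * d ^ 2 - 1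

theorem linkingGap_inner_symm (d : ℝ) (ζ ξ : C2) :
    linkingGap d (inner ℂ ξ ζ) = linkingGap d (inner ℂ ζ ξ) := by
  rw [← inner_conj_symm ζ ξ, linkingGap, linkingGap, RCLike.norm_conj, Complex.conj_re]

/-- Three vectors of `ℂ²` have zero Gram determinant. For `ζ, ξ, z` with both products against `z`
replaced by `d`, that determinant is minus the linking gap; the tube width controls the replacement
error. -/
theorem abs_linkingGap_le {ζ ξ z : C2} (hζ : ‖ζ‖ = 1) (hξ : ‖ξ‖ = 1) (hz : ‖z‖ = 1) {d ε : ℝ}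
    (hd : 0 ≤ d) (hd1 : d ≤ 1) (h₁ : ‖lineFun d ζ z‖ ≤ 2 * ε) (h₂ : ‖lineFun d ξ z‖ ≤ 2 * ε) :
    |linkingGap d (inner ℂ ζ ξ)| ≤ 16 * ε := by
  obtain ⟨v, hv⟩ := exists_isFrame hζ
  rw [lineFun] at h₁ h₂
  set c := inner ℂ ζ ξ
  set X := inner ℂ ζ z
  set W := inner ℂ ξ z with hW
  have hX1 : ‖X‖ ≤ 1 := by simpa [hζ, hz] using norm_inner_le_norm (𝕜 := ℂ) ζ z
  have hW1 : ‖W‖ ≤ 1 := by simpa [hξ, hz] using norm_inner_le_norm (𝕜 := ℂ) ξ z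
  have hc1 : ‖c‖ ≤ 1 := by simpa [hζ, hξ] using norm_inner_le_norm (𝕜 := ℂ) ζ ξ
  have hz2 := hv.norm_sq z
  have hξ2 := hv.norm_sq ξ
  have hWe : star (inner ℂ v ξ) * inner ℂ v z = W - star c * X := by
    rw [hW, hv.expand ξ, inner_add_left, inner_smul_left, inner_smul_left]
    simp only [starRingEnd_apply, hv.inner_right]
    ring
  have h3 := congrArg (fun x => ‖x‖ ^ 2) hWe
  simp only [norm_mul, norm_star, mul_pow] at h3
  have h4 : ‖W - star c * X‖ ^ 2
      = ‖W‖ ^ 2 + ‖c‖ ^ 2 * ‖X‖ ^ 2 - 2 * (c * (W * star X)).re := by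
    simp only [← Complex.normSq_eq_norm_sq, Complex.normSq_apply, Complex.star_def, Complex.sub_re,
      Complex.sub_im, Complex.mul_re, Complex.mul_im, Complex.conj_re, Complex.conj_im]
    ring
  rw [hz, one_pow] at hz2
  rw [hξ, one_pow] at hξ2
  have h5 : ‖inner ℂ v ξ‖ ^ 2 = 1 - ‖c‖ ^ 2 := by linarith
  have h6 : ‖inner ℂ v z‖ ^ 2 = 1 - ‖X‖ ^ 2 := by linarith
  rw [h4, h5, h6] at h3
  have h7 : linkingGap d c = 2 * (c * (W * star X - (d ^ 2 : ℝ))).re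
      + (d ^ 2 - ‖X‖ ^ 2) + (d ^ 2 - ‖W‖ ^ 2) := by
    have : (c * (W * star X - (d ^ 2 : ℝ))).re = (c * (W * star X)).re - d ^ 2 * c.re := by
      rw [mul_sub, Complex.sub_re, mul_comm c (_ : ℝ), Complex.re_ofReal_mul]
    rw [this, linkingGap]
    linarith
  have hsq : ∀ x : ℂ, ‖x - d‖ ≤ 2 * ε → ‖x‖ ≤ 1 → |d ^ 2 - ‖x‖ ^ 2| ≤ 4 * ε := fun x hx hx1 => by
    have e1 := abs_norm_sub_norm_le x d
    rw [Complex.norm_real, Real.norm_of_nonneg hd, abs_sub_comm] at e1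
    have e2 : d ^ 2 - ‖x‖ ^ 2 = (d - ‖x‖) * (d + ‖x‖) := by ring
    have e3 : 0 ≤ d + ‖x‖ := by positivity
    rw [e2, abs_mul, abs_of_nonneg e3]
    nlinarith [abs_nonneg (d - ‖x‖)]
  have h8 : |(c * (W * star X - (d ^ 2 : ℝ))).re| ≤ 4 * ε := by
    refine (Complex.abs_re_le_norm _).trans ?_
    have e1 : W * star X - (d ^ 2 : ℝ) = (W - d) * star X + d * star (X - d) := by
      simp only [star_sub, Complex.star_def, Complex.conj_ofReal]
      push_cast
      ring
    have e2 : ‖W * star X - (d ^ 2 : ℝ)‖ ≤ 4 * ε := by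
      rw [e1]
      refine (norm_add_le _ _).trans ?_
      rw [norm_mul, norm_mul, norm_star, norm_star, Complex.norm_real, Real.norm_of_nonneg hd]
      nlinarith [norm_nonneg (W - d), norm_nonneg (X - d), norm_nonneg X]
    rw [norm_mul]
    nlinarith [norm_nonneg (W * star X - (d ^ 2 : ℝ)), norm_nonneg c]
  have h9 := abs_le.1 (hsq X h₁ hX1)
  have h10 := abs_le.1 (hsq W h₂ hW1)
  have h11 := abs_le.1 h8
  rw [h7, abs_le]
  constructor <;> linarith [h9.1, h9.2, h10.1, h10.2, h11.1, h11.2]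

theorem disjoint_torus_lineFun {ζ ξ : C2} (hζ : ‖ζ‖ = 1) (hξ : ‖ξ‖ = 1) {d ε : ℝ}
    (hd : 0 ≤ d) (hd1 : d ≤ 1) (h : 16 * ε < |linkingGap d (inner ℂ ζ ξ)|) :
    Disjoint (torus (lineFun d ζ) (2 * ε)) (torus (lineFun d ξ) (2 * ε)) := by
  rw [Set.disjoint_left]
  rintro z ⟨hz, h₁⟩ ⟨-, h₂⟩
  exact h.not_ge (abs_linkingGap_le hζ hξ (mem_sphere_zero_iff_norm.1 hz) hd hd1 h₁ h₂)

/-- Two distinct lines of the family through the point `(d / a) • u`. -/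
theorem linkingGap_family {u v : C2} (hf : IsFrame u v) {a b d : ℝ} (hab : a ^ 2 + b ^ 2 = 1)
    (x y : ℂ) (hx : ‖x‖ = 1) (hy : ‖y‖ = 1) :
    linkingGap d (inner ℂ ((a : ℂ) • u + ((b : ℂ) * x) • v) ((a : ℂ) • u + ((b : ℂ) * y) • v))
      = - ((a ^ 2 - d ^ 2) * b ^ 2 * ‖x - y‖ ^ 2) := by
  have h1 : inner ℂ ((a : ℂ) • u + ((b : ℂ) * x) • v) ((a : ℂ) • u + ((b : ℂ) * y) • v)
      = a ^ 2 + b ^ 2 * (star x * y) := by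
    rw [inner_add_left, inner_smul_left, inner_smul_left, hf.inner_left, hf.inner_right]
    simp only [map_mul, Complex.conj_ofReal, Complex.star_def]
    ring
  have hx2 : x.re * x.re + x.im * x.im = 1 := by
    rw [← Complex.normSq_apply, Complex.normSq_eq_norm_sq, hx, one_pow]
  have hy2 : y.re * y.re + y.im * y.im = 1 := by
    rw [← Complex.normSq_apply, Complex.normSq_eq_norm_sq, hy, one_pow]
  rw [h1, linkingGap, ← Complex.normSq_eq_norm_sq, ← Complex.normSq_eq_norm_sq,
    Complex.normSq_apply, Complex.normSq_apply]
  simp only [Complex.add_re, Complex.add_im, Complex.mul_re, Complex.mul_im, Complex.star_def,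
    Complex.conj_re, Complex.conj_im, Complex.sub_re, Complex.sub_im, ← Complex.ofReal_pow,
    Complex.ofReal_re, Complex.ofReal_im]
  rw [show a ^ 2 = 1 - b ^ 2 by linarith]
  linear_combination b ^ 2 * b ^ 2 * ((y.re * y.re + y.im * y.im) * hx2 + hy2)
    + (1 - b ^ 2 - d ^ 2) * b ^ 2 * (hx2 + hy2)

theorem linkingGap_exp_mul (d ψ : ℝ) (c : ℂ) :
    linkingGap d (Complex.exp (ψ * Complex.I) * c)
      = ‖c‖ ^ 2 - 2 * d ^ 2 * (c.re * Real.cos ψ - c.im * Real.sin ψ) + 2 * d ^ 2 - 1 := by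
  rw [linkingGap, norm_mul, Complex.norm_exp_ofReal_mul_I, one_mul, Complex.mul_re,
    Complex.exp_ofReal_mul_I_re, Complex.exp_ofReal_mul_I_im]
  ring

theorem half_abs_le_abs_sin {x : ℝ} (hx : |x| ≤ 1) : |x| / 2 ≤ |Real.sin x| := by
  have h1 : ∀ y : ℝ, 0 ≤ y → y ≤ 1 → y / 2 ≤ Real.sin y := fun y hy hy1 => by
    have h2 := Real.mul_le_sin hy (by linarith [Real.pi_gt_three])
    have h3 : 1 / 2 ≤ 2 / Real.pi := by
      rw [div_le_div_iff₀ (by norm_num) Real.pi_pos]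
      linarith [Real.pi_le_four]
    nlinarith
  rcases le_total 0 x with h | h
  · rw [abs_of_nonneg h] at *
    exact (h1 x h hx).trans (le_abs_self _)
  · rw [abs_of_nonpos h] at *
    have := h1 (-x) (by linarith) hx
    rw [Real.sin_neg] at this
    exact this.trans (neg_le_abs _)

/-- Multiplication by a phase makes the linking gap small for few phases only. -/
theorem not_three_small_linkingGap {d ε : ℝ} (hd : 7 / 8 ≤ d ^ 2) (hε : 0 < ε) (hε1 : ε < 1 / 64)
    (c : ℂ) {ψ : Fin 3 → ℝ} (hψ : ∀ i, ψ i ∈ Set.Icc (0 : ℝ) 1)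
    (hs : ∀ i j, i ≠ j → 80 * Real.sqrt ε ≤ |ψ i - ψ j|)
    (hg : ∀ i, |linkingGap d (Complex.exp (ψ i * Complex.I) * c)| ≤ 16 * ε) : False := by
  simp_rw [linkingGap_exp_mul] at hg
  set k : ℝ → ℝ := fun x => c.re * Real.cos x - c.im * Real.sin x with hk
  have hc2 : ‖c‖ ^ 2 = c.re ^ 2 + c.im ^ 2 := by
    rw [← Complex.normSq_eq_norm_sq, Complex.normSq_apply]; ring
  -- For small `c` the gap is at least `2 * (7 / 8) * (3 / 4) - 1 = 5 / 16`, whereas `16 * ε < 1 /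
  -- 4`.
  by_cases hc : ‖c‖ ≤ 1 / 4
  · have h1 := (abs_le.1 (hg 0)).2
    have h2 : c.re * Real.cos (ψ 0) - c.im * Real.sin (ψ 0) ≤ 1 / 4 := by
      refine le_of_sq_le_sq ?_ (by norm_num)
      have h3 := Real.sin_sq_add_cos_sq (ψ 0)
      have h4 : ‖c‖ ^ 2 ≤ (1 / 4) ^ 2 := pow_le_pow_left₀ (norm_nonneg _) hc 2
      nlinarith [sq_nonneg (c.re * Real.sin (ψ 0) + c.im * Real.cos (ψ 0))]
    nlinarith [sq_nonneg ‖c‖]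
  push Not at hc
  set s := Real.sqrt ε with hs'
  have hs0 : 0 < s := Real.sqrt_pos.2 hε
  have hss : s ^ 2 = ε := Real.sq_sqrt hε.le
  have hs1 : s < 1 / 8 := by nlinarith
  -- `E = -k'`. Two phases with small gap make `E` of order `√ε` at their midpoint. Two such
  -- midpoints are at least `40 √ε` apart, but a sinusoid of amplitude `‖c‖ > 1 / 4` has large slope
  -- `D` where it is small.
  let E : ℝ → ℝ := fun m => c.re * Real.sin m + c.im * Real.cos m
  have hE : ∀ i j, i ≠ j → |E ((ψ i + ψ j) / 2)| ≤ 1 / 2 * s := fun i j hij => by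
    have h1 := abs_le.1 (hg i)
    have h2 := abs_le.1 (hg j)
    have h3 : |k (ψ i) - k (ψ j)| ≤ 20 * ε := by
      rw [abs_le]
      constructor <;> nlinarith [h1.1, h1.2, h2.1, h2.2]
    have h4 : k (ψ i) - k (ψ j)
        = - 2 * Real.sin ((ψ i - ψ j) / 2) * E ((ψ i + ψ j) / 2) := by
      have e1 := Real.cos_sub_cos (ψ i) (ψ j)
      have e2 := Real.sin_sub_sin (ψ i) (ψ j)
      simp only [hk, E]
      linear_combination c.re * e1 - c.im * e2
    have hi := hψ i
    have hj := hψ j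
    have h5 : |(ψ i - ψ j) / 2| ≤ 1 := by
      rw [abs_le]
      constructor <;> linarith [hi.1, hi.2, hj.1, hj.2]
    have h6 := half_abs_le_abs_sin h5
    rw [abs_div, abs_two] at h6
    have h7 := hs i j hij
    rw [h4, abs_mul, abs_mul, abs_neg, abs_two] at h3
    have h8 : 20 * s ≤ |Real.sin ((ψ i - ψ j) / 2)| := by linarith
    have h9 : 2 * (20 * s) * |E ((ψ i + ψ j) / 2)| ≤ 20 * s ^ 2 := by
      rw [hss]
      nlinarith [abs_nonneg (E ((ψ i + ψ j) / 2))]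
    nlinarith [abs_nonneg (E ((ψ i + ψ j) / 2))]
  have hA := hE 0 1 (by decide)
  have hB := hE 1 2 (by decide)
  set m := (ψ 0 + ψ 1) / 2
  set μ := (ψ 2 - ψ 0) / 2 with hμ
  have hm : (ψ 1 + ψ 2) / 2 = m + μ := by simp only [m, μ]; ring
  rw [hm] at hB
  have h1 : E (m + μ) = Real.cos μ * E m
      + Real.sin μ * (c.re * Real.cos m - c.im * Real.sin m) := by
    simp only [E, Real.sin_add, Real.cos_add]
    ring
  have h2 : (c.re * Real.cos m - c.im * Real.sin m) ^ 2 + E m ^ 2 = ‖c‖ ^ 2 := by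
    rw [hc2]
    simp only [E]
    linear_combination (c.re ^ 2 + c.im ^ 2) * Real.sin_sq_add_cos_sq m
  set D := c.re * Real.cos m - c.im * Real.sin m
  have h3 : 1 / 6 ≤ |D| := by
    refine le_of_sq_le_sq ?_ (abs_nonneg _)
    rw [sq_abs]
    have : E m ^ 2 ≤ (1 / 2 * s) ^ 2 := by
      rw [← sq_abs]
      exact pow_le_pow_left₀ (abs_nonneg _) hA 2
    nlinarith
  have h0 := hψ 0
  have h2' := hψ 2
  have h5 : |μ| ≤ 1 := by
    rw [abs_le]
    constructor <;> linarith [h0.1, h0.2, h2'.1, h2'.2]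
  have h6 := half_abs_le_abs_sin h5
  have h7 := hs 2 0 (by decide)
  have h8 : 20 * s ≤ |Real.sin μ| := by
    rw [hμ, abs_div, abs_two] at h6
    linarith
  have h9 : |Real.sin μ * D| ≤ s := by
    have e1 : Real.sin μ * D = E (m + μ) - Real.cos μ * E m := by rw [h1]; ring
    rw [e1]
    refine (abs_sub _ _).trans ?_
    rw [abs_mul]
    nlinarith [Real.abs_cos_le_one μ, abs_nonneg (E m)]
  rw [abs_mul] at h9
  nlinarith [abs_nonneg D]

/-! ### Filling the ball by discs. -/

theorem polynomialHull_mono {A B : Set C2} (h : A ⊆ B) : polynomialHull A ⊆ polynomialHull B :=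
  fun _ hz p M hM => hz p M fun w hw => hM w (h hw)

/-- The maximum principle on discs in the lines `z₁ = const`. -/
theorem closedBall_inter_lineTube_subset_polynomialHull {A : Set C2} {R s σ : ℝ}
    (h : Metric.sphere (0 : C2) R ∩ lineTube s σ ⊆ polynomialHull A) :
    Metric.closedBall (0 : C2) R ∩ lineTube s σ ⊆ polynomialHull A := by
  rintro z ⟨hz, hzs⟩
  have hzR := mem_closedBall_zero_iff.1 hz
  have hR : 0 ≤ R := (norm_nonneg z).trans hzR
  rcases hzR.eq_or_lt with hzR | hzR
  · exact h ⟨mem_sphere_zero_iff_norm.2 hzR, hzs⟩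
  intro p M hM
  obtain ⟨P, hP⟩ := exists_bivariate (!₂[1, 0]) (!₂[0, 1]) p
  have hP' : ∀ x y : ℂ, P.evalEval x y = MvPolynomial.eval (fun i => (!₂[x, y] : C2) i) p :=
    fun x y => by
      rw [hP]
      congr 2
      ext i
      fin_cases i <;> simp
  have hzz : z = !₂[z 0, z 1] := by
    ext i
    fin_cases i <;> rfl
  have hnorm : ∀ x y : ℂ, ‖(!₂[x, y] : C2)‖ ^ 2 = ‖x‖ ^ 2 + ‖y‖ ^ 2 := fun x y => by
    rw [EuclideanSpace.norm_sq_eq, Fin.sum_univ_two]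
    rfl
  have hlt : ‖z 0‖ ^ 2 + ‖z 1‖ ^ 2 < R ^ 2 := by
    rw [← hnorm, ← hzz]
    exact pow_lt_pow_left₀ hzR (norm_nonneg _) two_ne_zero
  -- The radius of the disc cut out of the ball by the line through `z`; its boundary circle lies on
  -- the sphere and in the tube.
  set T := Real.sqrt (R ^ 2 - ‖z 0‖ ^ 2) with hT
  have hT2 : T ^ 2 = R ^ 2 - ‖z 0‖ ^ 2 := Real.sq_sqrt (by nlinarith [sq_nonneg ‖z 1‖])
  have hT0 : 0 < T := Real.sqrt_pos.2 (by nlinarith [sq_nonneg ‖z 1‖])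
  have hd : Differentiable ℂ fun y => P.evalEval (z 0) y := by
    have : (fun y => P.evalEval (z 0) y)
        = fun y => (P.map (Polynomial.evalRingHom (z 0))).eval y := by
      ext y
      rw [Polynomial.map_evalRingHom_eval]
    rw [this]
    exact Polynomial.differentiable _
  have hz1 : z 1 ∈ Metric.ball (0 : ℂ) T := by
    rw [mem_ball_zero_iff]
    exact lt_of_pow_lt_pow_left₀ 2 hT0.le (by linarith)
  have key := Complex.norm_le_of_forall_mem_frontier_norm_le (C := M) Metric.isBounded_ball
    hd.diffContOnCl (fun y hy => ?_) (subset_closure hz1)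
  · rwa [hP', ← hzz] at key
  · rw [frontier_ball _ hT0.ne', mem_sphere_zero_iff_norm] at hy
    rw [hP']
    refine h (a := !₂[z 0, y]) ⟨mem_sphere_zero_iff_norm.2 ?_, hzs⟩ p M hM
    rw [← sq_eq_sq₀ (norm_nonneg _) hR, hnorm, hy, hT2]
    ring

/-! ### Choice of phases by counting. -/

open Classical in
/-- A phase which separates the circles of finitely many lines from those of finitely many
others. -/
theorem exists_phase {α β : Type*} [Fintype α] [Fintype β] (ζ : α → C2) (ξ : β → C2) {d ε η : ℝ}
    (hd : 7 / 8 ≤ d ^ 2) (hε : 0 < ε) (hε1 : ε < 1 / 64) (hη : η ≤ 1)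
    (hcount : 2 * (Fintype.card α * Fintype.card β : ℕ) * (80 * Real.sqrt ε) ≤ η) :
    ∃ ψ ∈ Set.Icc 0 η, ∀ i j,
      16 * ε < |linkingGap d (inner ℂ (ζ i) (Complex.exp (ψ * Complex.I) • ξ j))| := by
  have hτ : 0 < 80 * Real.sqrt ε := by positivity
  set τ := 80 * Real.sqrt ε with hτ'
  set N := Fintype.card α * Fintype.card β with hN
  -- Each of the `N` pairs spoils at most two of the `2 * N + 1` grid phases `k * τ`, so one
  -- survives. The mesh `τ` is the separation needed in `not_three_small_linkingGap`.
  let bad : α × β → Finset ℕ := fun q => (Finset.range (2 * N + 1)).filter fun k =>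
    |linkingGap d (inner ℂ (ζ q.1) (Complex.exp ((k * τ : ℝ) * Complex.I) • ξ q.2))| ≤ 16 * ε
  have hmem : ∀ k ∈ Finset.range (2 * N + 1), (k * τ : ℝ) ∈ Set.Icc 0 η := fun k hk => by
    have h1 : (k : ℝ) ≤ 2 * N := by
      have := Finset.mem_range.1 hk
      exact_mod_cast (by omega : k ≤ 2 * N)
    exact ⟨by positivity, (mul_le_mul_of_nonneg_right h1 hτ.le).trans hcount⟩
  have hbad : ∀ q, (bad q).card ≤ 2 := fun q => by
    by_contra! h
    obtain ⟨x, y, z, hx, hy, hz, hxy, hxz, hyz⟩ := Finset.two_lt_card_iff.1 h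
    have hk : ∀ i, (![x, y, z] : Fin 3 → ℕ) i ∈ bad q := by
      intro i
      fin_cases i
      · exact hx
      · exact hy
      · exact hz
    refine not_three_small_linkingGap hd hε hε1 (inner ℂ (ζ q.1) (ξ q.2))
      (ψ := fun i => ((![x, y, z] : Fin 3 → ℕ) i : ℝ) * τ) (fun i => ?_) (fun i j hij => ?_)
      (fun i => ?_)
    · have := hmem _ (Finset.mem_filter.1 (hk i)).1
      exact ⟨this.1, this.2.trans hη⟩
    · have hne : (![x, y, z] : Fin 3 → ℕ) i ≠ (![x, y, z] : Fin 3 → ℕ) j := by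
        fin_cases i <;> fin_cases j <;> simp_all [eq_comm]
      rw [← sub_mul, abs_mul, abs_of_pos hτ]
      have h1 : (1 : ℝ) ≤ |((![x, y, z] : Fin 3 → ℕ) i : ℝ) - ((![x, y, z] : Fin 3 → ℕ) j : ℝ)| := by
        have h2 : (1 : ℤ) ≤ |((![x, y, z] : Fin 3 → ℕ) i : ℤ) - ((![x, y, z] : Fin 3 → ℕ) j : ℤ)| :=
          Int.one_le_abs (sub_ne_zero.2 (by exact_mod_cast hne))
        exact_mod_cast h2
      exact le_mul_of_one_le_left hτ.le h1
    · have := (Finset.mem_filter.1 (hk i)).2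
      rwa [inner_smul_right] at this
  have hcard : (Finset.univ.biUnion bad).card < (Finset.range (2 * N + 1)).card := by
    refine (Finset.card_biUnion_le.trans (Finset.sum_le_sum fun q _ => hbad q)).trans_lt ?_
    rw [Finset.sum_const, Finset.card_univ, Fintype.card_prod, Finset.card_range, smul_eq_mul, ← hN]
    omega
  obtain ⟨k, hk, hk'⟩ := Finset.exists_mem_notMem_of_card_lt_card hcard
  refine ⟨k * τ, hmem k hk, fun i j => ?_⟩
  by_contra! h
  exact hk' (Finset.mem_biUnion.2 ⟨(i, j), Finset.mem_univ _, Finset.mem_filter.2 ⟨hk, h⟩⟩)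

open Classical in
/-- Phases which separate the circles of finitely many families of lines. -/
theorem exists_phases {ι β : Type*} [Fintype ι] [Fintype β] (ζ : ι → β → C2) {d ε η : ℝ}
    (hd : 7 / 8 ≤ d ^ 2) (hε : 0 < ε) (hε1 : ε < 1 / 64) (hη : η ≤ 1)
    (hcount : 2 * (Fintype.card ι * Fintype.card β * Fintype.card β : ℕ) * (80 * Real.sqrt ε) ≤ η) :
    ∃ ψ : ι → ℝ, (∀ i, ψ i ∈ Set.Icc 0 η) ∧ ∀ i j, i ≠ j → ∀ m n,
      16 * ε < |linkingGap d (inner ℂ (Complex.exp (ψ i * Complex.I) • ζ i m)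
        (Complex.exp (ψ j * Complex.I) • ζ j n))| := by
  have hη0 : 0 ≤ η := le_trans (by positivity) hcount
  suffices H : ∀ s : Finset ι, ∃ ψ : ι → ℝ, (∀ i, ψ i ∈ Set.Icc 0 η) ∧ ∀ i ∈ s, ∀ j ∈ s, i ≠ j →
      ∀ m n, 16 * ε < |linkingGap d (inner ℂ (Complex.exp (ψ i * Complex.I) • ζ i m)
        (Complex.exp (ψ j * Complex.I) • ζ j n))| by
    obtain ⟨ψ, h1, h2⟩ := H Finset.univ
    exact ⟨ψ, h1, fun i j => h2 i (Finset.mem_univ _) j (Finset.mem_univ _)⟩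
  intro s
  induction s using Finset.induction_on with
  | empty => exact ⟨fun _ => 0, fun _ => ⟨le_rfl, hη0⟩, by simp⟩
  | insert i₀ s hi₀ ih =>
    obtain ⟨ψ, h1, h2⟩ := ih
    -- The vectors with phases already fixed form one group, the new family the other.
    obtain ⟨x, hx, hx'⟩ := exists_phase
      (fun q : s × β => Complex.exp (ψ q.1 * Complex.I) • ζ q.1 q.2) (ζ i₀) hd hε hε1 hη (by
        refine le_trans ?_ hcount
        gcongr
        rw [Fintype.card_prod, Fintype.card_coe]
        gcongr
        exact Finset.card_le_univ s)
    refine ⟨Function.update ψ i₀ x, fun i => ?_, ?_⟩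
    · by_cases hi : i = i₀
      · rw [hi, Function.update_self]
        exact hx
      · rw [Function.update_of_ne hi]
        exact h1 i
    · have hne : ∀ i ∈ s, i ≠ i₀ := fun i hi h => hi₀ (h ▸ hi)
      intro i hi j hj hij m n
      rcases Finset.mem_insert.1 hi with rfl | hi' <;> rcases Finset.mem_insert.1 hj with rfl | hj'
      · exact absurd rfl hij
      · rw [Function.update_self, Function.update_of_ne (hne j hj'), linkingGap_inner_symm]
        exact hx' (⟨j, hj'⟩, n) m
      · rw [Function.update_self, Function.update_of_ne (hne i hi')]
        exact hx' (⟨i, hi'⟩, m) n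
      · rw [Function.update_of_ne (hne i hi'), Function.update_of_ne (hne j hj')]
        exact h2 i hi' j hj' hij m n

/-! ### Parameters and estimates for the families. -/

/-- The number of lines of a family can be taken of the order of `log (1 / ε)`. -/
theorem exists_card {γ : ℝ} (hγ : 0 < γ) : ∃ ε₀ : ℝ, 0 < ε₀ ∧ ∀ ε ∈ Set.Ioo 0 ε₀,
    ∃ K : ℕ, 0 < K ∧ 4 / ε ≤ 2 ^ K ∧ (K : ℝ) ^ 2 * Real.sqrt ε < γ := by
  have h := tendsto_pow_const_div_const_pow_of_one_lt 4 (one_lt_two (α := ℝ))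
  obtain ⟨K₀, hK₀⟩ := eventually_atTop.1 (h.eventually_lt_const (show 0 < γ ^ 2 / 8 by positivity))
  refine ⟨4 / 2 ^ K₀, by positivity, fun ε ⟨hε, hε₀⟩ => ?_⟩
  rw [lt_div_iff₀ (by positivity)] at hε₀
  have h1 : (1 : ℝ) ≤ 2 ^ K₀ := one_le_pow₀ one_le_two
  -- `K = n + 1` is the least exponent with `4 / ε < 2 ^ K`, so `2 ^ K * ε ≤ 8` and `K⁴ ε ≤ 8 K⁴ /
  -- 2^K`, which is small; `ε < ε₀` forces `K ≥ K₀`.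
  obtain ⟨n, hn, hn'⟩ := exists_nat_pow_near (x := 4 / ε) (y := 2)
    (by rw [le_div_iff₀ hε]; nlinarith) one_lt_two
  refine ⟨n + 1, n.succ_pos, hn'.le, ?_⟩
  rw [le_div_iff₀ hε] at hn
  have hKn : K₀ ≤ n + 1 := by
    by_contra! hlt
    have h2 : (2 : ℝ) ^ (n + 1) ≤ 2 ^ K₀ := pow_le_pow_right₀ one_le_two hlt.le
    rw [div_lt_iff₀ hε] at hn'
    nlinarith
  have h3 := hK₀ (n + 1) hKn
  rw [div_lt_iff₀ (by positivity)] at h3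
  refine lt_of_pow_lt_pow_left₀ 2 hγ.le ?_
  rw [mul_pow, Real.sq_sqrt hε.le, ← pow_mul]
  have h4 : (2 : ℝ) ^ (n + 1) * ε ≤ 8 := by rw [pow_succ]; linarith
  push_cast at h3 ⊢
  nlinarith

theorem four_div_le_norm_pow_sub_pow {K : ℕ} {m n : ℕ} (hm : m < K) (hn : n < K) (hmn : m ≠ n) :
    4 / K ≤ ‖Complex.exp (2 * Real.pi * Complex.I / K) ^ m
      - Complex.exp (2 * Real.pi * Complex.I / K) ^ n‖ := by
  wlog h : m < n generalizing m n
  · rw [norm_sub_rev]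
    exact this hn hm hmn.symm (by omega)
  set w := Complex.exp (2 * Real.pi * Complex.I / K) with hw
  have hK : K ≠ 0 := by omega
  have hK0 : (0 : ℝ) < K := by exact_mod_cast Nat.pos_of_ne_zero hK
  have hw1 : ‖w‖ = 1 := (Complex.isPrimitiveRoot_exp K hK).norm'_eq_one hK
  obtain ⟨k, rfl⟩ := Nat.exists_eq_add_of_lt h
  set l := k + 1 with hl
  have hlK : (l : ℝ) + 1 ≤ K := by exact_mod_cast (by omega : l + 1 ≤ K)
  have hl1 : (1 : ℝ) ≤ l := by exact_mod_cast (by omega : 1 ≤ l)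
  have h1 : w ^ l = Complex.exp (Complex.I * ((2 * (Real.pi * l / K) : ℝ) : ℂ)) := by
    rw [hw, ← Complex.exp_nat_mul]
    congr 1
    push_cast
    ring
  rw [show m + k + 1 = m + l by omega, norm_sub_rev,
    show w ^ (m + l) - w ^ m = w ^ m * (w ^ l - 1) by ring,
    norm_mul, norm_pow, hw1, one_pow, one_mul, h1, Complex.norm_exp_I_mul_ofReal_sub_one,
    mul_div_cancel_left₀ _ two_ne_zero, norm_mul, Real.norm_ofNat]
  suffices 2 / K ≤ Real.sin (Real.pi * l / K) by
    have h2 := this.trans (le_abs_self _)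
    rw [Real.norm_eq_abs]
    linarith [show (4 : ℝ) / K = 2 * (2 / K) by ring]
  have hpi := Real.pi_pos
  rcases le_total (2 * (l : ℝ)) K with hlK' | hlK'
  · refine le_trans ?_ (Real.mul_le_sin (by positivity) ?_)
    · rw [div_mul_div_comm, div_le_div_iff₀ hK0 (by positivity)]
      nlinarith [mul_pos hpi hK0]
    · rw [div_le_div_iff₀ hK0 two_pos]
      nlinarith
  · rw [← Real.sin_pi_sub]
    have e : Real.pi - Real.pi * l / K = Real.pi * (K - l) / K := by field_simp
    rw [e]
    have hKl : (1 : ℝ) ≤ K - l := by linarith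
    refine le_trans ?_ (Real.mul_le_sin (by positivity) ?_)
    · rw [div_mul_div_comm, div_le_div_iff₀ hK0 (by positivity)]
      nlinarith [mul_pos hpi hK0]
    · rw [div_le_div_iff₀ hK0 two_pos]
      nlinarith

theorem IsFrame.norm_family {u v : C2} (hf : IsFrame u v) {a b : ℝ} (hab : a ^ 2 + b ^ 2 = 1)
    {x : ℂ} (hx : ‖x‖ = 1) : ‖(a : ℂ) • u + ((b : ℂ) * x) • v‖ = 1 := by
  rw [← pow_eq_one_iff_of_nonneg (norm_nonneg _) two_ne_zero, hf.norm_sq_add, norm_mul,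
    Complex.norm_real, Complex.norm_real, hx, mul_one, Real.norm_eq_abs, Real.norm_eq_abs, sq_abs,
    sq_abs, hab]

/-- The points of the tube around a line at distance `d` are close to every point of this line. -/
theorem norm_sub_sq_le_of_norm_lineFun_le {ζ z : C2} (hζ : ‖ζ‖ = 1) (hz : ‖z‖ ≤ 1) {d δ : ℝ}
    (h : ‖lineFun d ζ z‖ ≤ δ) : ‖z - ζ‖ ^ 2 ≤ 2 * (1 - d) + 2 * δ := by
  have h1 : d - δ ≤ (inner ℂ ζ z).re := by
    have h2 := (abs_le.1 ((Complex.abs_re_le_norm _).trans h)).1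
    rw [lineFun, Complex.sub_re, Complex.ofReal_re] at h2
    linarith
  have h3 := norm_sub_sq (𝕜 := ℂ) ζ z
  rw [hζ] at h3
  rw [norm_sub_rev, h3]
  have h4 : RCLike.re (inner ℂ ζ z) = (inner ℂ ζ z).re := rfl
  rw [h4]
  nlinarith [norm_nonneg z]

/-- The relation `a * (1 - t / 2) = 1 - t` places the common point at radius `1 - t / 2`. As this is
below `1`, `a` exceeds `1 - t` and the circles of a family are disjoint. The bound `t / 8` on `c / a
+ c / b` fits below the distance `t / 4` from that radius to the smallest admissible `r`. -/
theorem exists_family_parameters {t : ℝ} (ht : 0 < t) (ht1 : t < 1 / 32) :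
    ∃ a b c : ℝ, 0 < a ∧ 0 < b ∧ a ^ 2 + b ^ 2 = 1 ∧ a * (1 - t / 2) = 1 - t ∧ 1 - t < a ∧
      0 < c ∧ c ≤ t / 16 ∧ c / a + c / b ≤ t / 8 := by
  have hR0 : 0 < 1 - t / 2 := by linarith
  have hd0 : 0 < 1 - t := by linarith
  obtain ⟨a, haR⟩ : ∃ a, a * (1 - t / 2) = 1 - t := ⟨_, div_mul_cancel₀ _ hR0.ne'⟩
  have ha0 : 0 < a := by
    by_contra! h
    nlinarith
  have ha1 : a < 1 := by
    by_contra! h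
    nlinarith
  have had : 1 - t < a := by nlinarith
  have hb2 : 0 < 1 - a ^ 2 := by nlinarith
  obtain ⟨b, hb0, hb⟩ : ∃ b, 0 < b ∧ b ^ 2 = 1 - a ^ 2 :=
    ⟨_, Real.sqrt_pos.2 hb2, Real.sq_sqrt hb2.le⟩
  have hb1 : b ≤ 1 := by nlinarith
  have hab1 : a * b ≤ 1 := by nlinarith
  refine ⟨a, b, t / 16 * (a * b), ha0, hb0, by linarith, haR, had, by positivity, ?_, ?_⟩
  · exact mul_le_of_le_one_right (by positivity) hab1
  · have e1 : t / 16 * (a * b) / a + t / 16 * (a * b) / b = t / 16 * (a + b) := by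
      field_simp
      ring
    rw [e1]
    nlinarith

/-- The tubes around the lines through `R • u` are small if these lines are almost tangent to the
unit sphere. -/
theorem norm_sub_le_of_mem_torus {u v : C2} (hf : IsFrame u v) {a b d R δ σ : ℝ} {x : ℂ}
    (hab : a ^ 2 + b ^ 2 = 1) (hx : ‖x‖ = 1) (haR : a * R = d) (hR0 : 0 ≤ R) (hR1 : R ≤ 1)
    (hσ : 0 ≤ σ) (hd : 2 * (1 - d) ≤ (σ / 4) ^ 2) (hδ : 2 * (1 - d) + 2 * δ ≤ (σ / 2) ^ 2)
    {q z : C2} (hq : ‖q - (R : ℂ) • u‖ ≤ σ / 4)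
    (hz : z ∈ torus (lineFun d ((a : ℂ) • u + ((b : ℂ) * x) • v)) δ) : ‖z - q‖ ≤ σ := by
  obtain ⟨hz, hzf⟩ := hz
  have hζ := hf.norm_family hab hx
  have h1 : ‖z - ((a : ℂ) • u + ((b : ℂ) * x) • v)‖ ≤ σ / 2 :=
    le_of_sq_le_sq ((norm_sub_sq_le_of_norm_lineFun_le hζ
      (mem_sphere_zero_iff_norm.1 hz).le hzf).trans hδ) (by positivity)
  have h2 : ‖(R : ℂ) • u - ((a : ℂ) • u + ((b : ℂ) * x) • v)‖ ≤ σ / 4 := by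
    refine le_of_sq_le_sq ?_ (by positivity)
    have h3 : ‖(R : ℂ) • u‖ ≤ 1 := by
      rwa [norm_smul, hf.1, mul_one, Complex.norm_real, Real.norm_of_nonneg hR0]
    have h4 : lineFun d ((a : ℂ) • u + ((b : ℂ) * x) • v) ((R : ℂ) • u) = 0 := by
      rw [lineFun, inner_smul_right, ← inner_conj_symm, hf.inner_left, Complex.conj_ofReal, ← haR]
      push_cast
      ring
    have := norm_sub_sq_le_of_norm_lineFun_le hζ h3 (by rw [h4, norm_zero])
    linarith
  have e : z - q = (z - ((a : ℂ) • u + ((b : ℂ) * x) • v))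
      - ((R : ℂ) • u - ((a : ℂ) • u + ((b : ℂ) * x) • v)) - (q - (R : ℂ) • u) := by abel
  rw [e]
  refine (norm_sub_le _ _).trans ((add_le_add (norm_sub_le _ _) hq).trans ?_)
  linarith

theorem lt_abs_linkingGap_family {u v : C2} (hf : IsFrame u v) {a b d ε : ℝ}
    (hab : a ^ 2 + b ^ 2 = 1) (hκ : 0 < a ^ 2 - d ^ 2) (hε : 0 < ε) (hε1 : ε ≤ 1) {K : ℕ}
    (hK : 0 < K) (hKε : (K : ℝ) ^ 2 * Real.sqrt ε < (a ^ 2 - d ^ 2) * b ^ 2) {x y : ℂ}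
    (hx : ‖x‖ = 1) (hy : ‖y‖ = 1) (hxy : 4 / K ≤ ‖x - y‖) :
    16 * ε < |linkingGap d (inner ℂ ((a : ℂ) • u + ((b : ℂ) * x) • v)
      ((a : ℂ) • u + ((b : ℂ) * y) • v))| := by
  have hKR : (0 : ℝ) < K := by exact_mod_cast hK
  have hP : 0 ≤ (a ^ 2 - d ^ 2) * b ^ 2 := mul_nonneg hκ.le (sq_nonneg b)
  rw [linkingGap_family hf hab x y hx hy, abs_neg, abs_of_nonneg (mul_nonneg hP (sq_nonneg _))]
  generalize (a ^ 2 - d ^ 2) * b ^ 2 = P at *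
  have h1 : (4 / K : ℝ) ^ 2 ≤ ‖x - y‖ ^ 2 := pow_le_pow_left₀ (by positivity) hxy 2
  have h2 : (K : ℝ) ^ 2 * ε < P := by
    refine lt_of_le_of_lt ?_ hKε
    have : ε ≤ Real.sqrt ε := Real.le_sqrt_of_sq_le (by nlinarith)
    gcongr
  refine lt_of_lt_of_le ?_ (mul_le_mul_of_nonneg_left h1 hP)
  rw [div_pow, mul_div_assoc', lt_div_iff₀ (by positivity)]
  linarith

/-! ### Assembly. -/

theorem exists_tori_of_small_radius {s σ t ρ : ℝ} (hσ : 0 < σ) (hσ1 : σ < 1) (ht : t = σ ^ 2 / 32)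
    (hρ : ρ = t / 2) : ∃ ε' : ℝ, 0 < ε' ∧ ∀ ε ∈ Set.Ioo 0 ε', ∃ (J : Type) (_ : Fintype J)
      (ζ : J → C2), (∀ j, ‖ζ j‖ = 1) ∧ 2 * ε < t ∧
      (∀ i j, i ≠ j → Disjoint (torus (lineFun (1 - t) (ζ i)) (2 * ε))
        (torus (lineFun (1 - t) (ζ j)) (2 * ε))) ∧
      (∀ j, torus (lineFun (1 - t) (ζ j)) (2 * ε) ⊆ lineTube s (2 * σ)) ∧
      ∀ r ∈ Set.Icc (1 - ρ / 2) 1, Metric.closedBall (0 : C2) (1 - ρ) ∩ lineTube s σ ⊆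
        polynomialHull (⋃ j, radiusTorus r (lineFun (1 - t) (ζ j)) ε) := by
  have hσ2 : σ ^ 2 < 1 := by nlinarith
  have hσ20 : 0 < σ ^ 2 := by positivity
  have ht0 : 0 < t := by linarith
  have hρ0 : 0 < ρ := by linarith
  set d := 1 - t with hd
  set R := 1 - ρ with hR
  have hd0 : 0 < d := by linarith
  have hR0 : 0 < R := by linarith
  have hd2 : 7 / 8 ≤ d ^ 2 := by nlinarith
  obtain ⟨a, b, c, ha0, hb0, hab, haR, had, hc0, hct, hcab⟩ := exists_family_parameters ht0
    (show t < 1 / 32 by linarith)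
  rw [← hρ] at haR
  have hda : d / a = R := by
    rw [div_eq_iff ha0.ne', mul_comm]
    exact haR.symm
  have hcρ : c ≤ ρ / 8 := by linarith
  have hκ : 0 < a ^ 2 - d ^ 2 := sub_pos.2 (pow_lt_pow_left₀ had hd0.le two_ne_zero)
  -- a finite net of the part of the sphere of radius `R` in the tube
  obtain ⟨N, hN, hNfin, hcover⟩ := finite_cover_balls_of_compact (e := c / 8)
    (s := Metric.sphere (0 : C2) R ∩ lineTube s σ)
    ((isCompact_sphere _ _).inter_right (by
      refine isClosed_le (f := fun z : C2 => ‖z 0 - (1 - (s : ℂ))‖) ?_ continuous_const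
      fun_prop)) (by positivity)
  have : Fintype N := hNfin.fintype
  have hNn : ∀ i : N, ‖(i : C2)‖ = R := fun i => mem_sphere_zero_iff_norm.1 (hN i.2).1
  have hRC : (R : ℂ) ≠ 0 := by exact_mod_cast hR0.ne'
  obtain ⟨u, hu, hNu⟩ : ∃ u : N → C2, (∀ i, ‖u i‖ = 1) ∧ ∀ i : N, (i : C2) = (R : ℂ) • u i := by
    refine ⟨fun i => (R : ℂ)⁻¹ • (i : C2), fun i => ?_, fun i => (smul_inv_smul₀ hRC _).symm⟩
    rw [norm_smul, hNn, norm_inv, Complex.norm_real, Real.norm_of_nonneg hR0.le,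
      inv_mul_cancel₀ hR0.ne']
  choose v hv using fun i => exists_isFrame (hu i)
  -- The first bound on `K² √ε` separates lines within a family; the second gives room in `[0, c /
  -- 8]` for the phase grid, `160` being `2 * 80`.
  have hγ : 0 < min ((a ^ 2 - d ^ 2) * b ^ 2) (c / 8 / (160 * (Fintype.card N + 1))) :=
    lt_min (by positivity) (by positivity)
  obtain ⟨ε₀, hε₀, hK⟩ := exists_card hγ
  refine ⟨min ε₀ (t / 2), by positivity, fun ε ⟨hε, hε'⟩ => ?_⟩
  have hεt : ε < t / 2 := hε'.trans_le (min_le_right _ _)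
  have hε64 : ε < 1 / 64 := by linarith
  obtain ⟨K, hK0, hK4, hKγ⟩ := hK ε ⟨hε, hε'.trans_le (min_le_left _ _)⟩
  rw [lt_min_iff] at hKγ
  obtain ⟨hKγ, hKc⟩ := hKγ
  obtain ⟨w, hw, hwmn⟩ : ∃ w : ℂ, IsPrimitiveRoot w K ∧
      ∀ m n, m < K → n < K → m ≠ n → 4 / K ≤ ‖w ^ m - w ^ n‖ :=
    ⟨_, Complex.isPrimitiveRoot_exp K hK0.ne', fun _ _ => four_div_le_norm_pow_sub_pow⟩
  have hw1 : ‖w‖ = 1 := hw.norm'_eq_one hK0.ne'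
  have hwn : ∀ n : ℕ, ‖w ^ n‖ = 1 := fun n => by rw [norm_pow, hw1, one_pow]
  obtain ⟨κ, hκ1, hκc, hκd⟩ : ∃ κ : N → ℂ, (∀ i, ‖κ i‖ = 1) ∧ (∀ i, ‖1 - κ i‖ ≤ c / 8) ∧
      ∀ i j, i ≠ j → ∀ m n : Fin K, 16 * ε < |linkingGap d
        (inner ℂ (κ i • ((a : ℂ) • u i + ((b : ℂ) * w ^ (m : ℕ)) • v i))
          (κ j • ((a : ℂ) • u j + ((b : ℂ) * w ^ (n : ℕ)) • v j)))| := by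
    obtain ⟨ψ, hψ, hψd⟩ := exists_phases
      (fun (i : N) (n : Fin K) => (a : ℂ) • u i + ((b : ℂ) * w ^ (n : ℕ)) • v i)
      hd2 hε hε64 (η := c / 8) (by linarith) (by
        rw [Fintype.card_fin]
        rw [lt_div_iff₀ (by positivity)] at hKc
        push_cast
        have : 0 ≤ (K : ℝ) ^ 2 * Real.sqrt ε := by positivity
        nlinarith)
    refine ⟨fun i => Complex.exp (ψ i * Complex.I), fun i => Complex.norm_exp_ofReal_mul_I _,
      fun i => ?_, hψd⟩
    rw [norm_sub_rev]
    have := Real.norm_exp_I_mul_ofReal_sub_one_le (x := ψ i)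
    rw [Real.norm_of_nonneg (hψ i).1, mul_comm] at this
    exact this.trans (hψ i).2
  have hf : ∀ i, IsFrame (κ i • u i) (κ i • v i) := fun i => (hv i).smul (hκ1 i)
  let ζ : N × Fin K → C2 := fun j =>
    (a : ℂ) • (κ j.1 • u j.1) + ((b : ℂ) * w ^ (j.2 : ℕ)) • (κ j.1 • v j.1)
  have hζκ : ∀ j, ζ j
      = κ j.1 • ((a : ℂ) • u j.1 + ((b : ℂ) * w ^ (j.2 : ℕ)) • v j.1) := fun j => by
    rw [smul_add, smul_comm (κ j.1) (a : ℂ), smul_comm (κ j.1) ((b : ℂ) * _)]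
  have hζ : ∀ j, ‖ζ j‖ = 1 := fun j => (hf j.1).norm_family hab (hwn _)
  -- the perturbed net
  have hnet : ∀ i : N, ‖(i : C2) - (R : ℂ) • κ i • u i‖ ≤ c / 8 := fun i => by
    have e2 : (i : C2) - (R : ℂ) • κ i • u i = (R : ℂ) • (1 - κ i) • u i := by
      rw [sub_smul, one_smul, smul_sub, ← hNu]
    rw [e2, norm_smul, norm_smul, hu, mul_one, Complex.norm_real, Real.norm_of_nonneg hR0.le]
    nlinarith [norm_nonneg (1 - κ i), hκc i]
  refine ⟨N × Fin K, inferInstance, ζ, hζ, by linarith, ?_, ?_, ?_⟩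
  · rintro ⟨i, m⟩ ⟨j, n⟩ hij
    refine disjoint_torus_lineFun (hζ _) (hζ _) hd0.le (by linarith) ?_
    by_cases h : i = j
    · subst h
      have hmn : (m : ℕ) ≠ n := fun h => hij (by rw [Fin.ext h])
      exact lt_abs_linkingGap_family (hf i) hab hκ hε (by linarith) hK0 hKγ (hwn _) (hwn _)
        (hwmn m n m.2 n.2 hmn)
    · rw [hζκ, hζκ]
      exact hκd i j h m n
  · rintro ⟨i, n⟩ z hz
    have h3 : ‖z - (i : C2)‖ ≤ σ :=
      -- Here `t = σ² / 32` is used: `2 * t = (σ / 4)²` exactly, and `2 * ε < t` leaves room for the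
      -- tube width.
      norm_sub_le_of_mem_torus (hf i) hab (hwn n) haR hR0.le (by linarith) hσ.le
        (by linarith [show (σ / 4) ^ 2 = σ ^ 2 / 16 by ring])
        (by linarith [show (σ / 2) ^ 2 = σ ^ 2 / 4 by ring]) ((hnet i).trans (by nlinarith)) hz
    have h4 : ‖(i : C2) 0 - (1 - (s : ℂ))‖ ≤ σ := (hN i.2).2
    have h5 : ‖z 0 - (i : C2) 0‖ ≤ σ := (PiLp.norm_apply_le (z - (i : C2)) 0).trans h3
    change ‖z 0 - (1 - (s : ℂ))‖ ≤ 2 * σ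
    have e : z 0 - (1 - (s : ℂ)) = (z 0 - (i : C2) 0) + ((i : C2) 0 - (1 - (s : ℂ))) := by ring
    rw [e]
    refine (norm_add_le _ _).trans ?_
    linarith
  · rintro r ⟨hr, hr1⟩
    refine closedBall_inter_lineTube_subset_polynomialHull fun q hq => ?_
    obtain ⟨p, hp, hqp⟩ := Set.mem_iUnion₂.1 (hcover hq)
    rw [Metric.mem_ball, dist_eq_norm] at hqp
    have hqR : ‖q‖ = R := mem_sphere_zero_iff_norm.1 hq.1
    refine polynomialHull_mono ?_ (mem_polynomialHull_iUnion_radiusTorus (hf ⟨p, hp⟩) ha0 hb0 hab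
      hc0 hr1 (by rw [hda]; linarith) hd0 hε (by linarith) hK4 hw (by linarith) ?_)
    · exact Set.iUnion_subset fun n => Set.subset_iUnion
        (fun j : N × Fin K => radiusTorus r (lineFun d (ζ j)) ε) (⟨p, hp⟩, n)
    · rw [hda]
      have e : q - (R : ℂ) • κ ⟨p, hp⟩ • u ⟨p, hp⟩
          = (q - p) + (p - (R : ℂ) • κ ⟨p, hp⟩ • u ⟨p, hp⟩) := by abel
      rw [e]
      refine (norm_add_le _ _).trans ?_
      linarith [hnet ⟨p, hp⟩]

theorem proposition4 (s : ℝ) (hs : s ∈ Set.Ioo (0 : ℝ) 1) :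
    ∃ σ' : ℝ, 0 < σ' ∧
    -- the constants `ρ(σ)`, `{s_m}(σ)`, `ε'(σ)`, `r'(σ)`; none of them depends on `ε`
    ∃ (ρ : ℝ → ℝ) (S : ℝ → Finset ℝ) (ε' r' : ℝ → ℝ),
      Tendsto ρ (𝓝[>] 0) (𝓝 0) ∧
      -- the numbers `s_m` tend to zero (uniformly in `m`) as `σ → 0`
      (∀ η : ℝ, 0 < η → ∃ σ₀ : ℝ, 0 < σ₀ ∧ ∀ σ ∈ Set.Ioo 0 σ₀, ∀ x ∈ S σ, x < η) ∧
      ∀ σ ∈ Set.Ioo 0 σ',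
        ρ σ ∈ Set.Ioo (0 : ℝ) 1 ∧
        (∀ x ∈ S σ, x ∈ Set.Ioo (0 : ℝ) 1) ∧
        0 < ε' σ ∧
        r' σ ∈ Set.Ioo (0 : ℝ) 1 ∧
        ∀ ε ∈ Set.Ioo 0 (ε' σ),
          ∃ (N : ℕ) (f : Fin N → C2 → ℂ),
            (∀ n, IsUnitAffine (f n)) ∧
            (∀ n, IsSolidTorus (torus (f n) (2 * ε))) ∧
            (∀ n, ∃ x ∈ S σ,
              UnitarilyEquivalent (torus (f n) (2 * ε)) (standardTorus x (2 * ε))) ∧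
            (∀ m n, m ≠ n → Disjoint (torus (f m) (2 * ε)) (torus (f n) (2 * ε))) ∧
            (∀ n, torus (f n) (2 * ε) ⊆ lineTube s (2 * σ)) ∧
            Metric.closedBall (0 : C2) (1 - ρ σ) ∩ lineTube s σ ⊆
              polynomialHull (⋃ n, torus (f n) ε) ∧
            ∀ r ∈ Set.Icc (r' σ) 1,
              Metric.closedBall (0 : C2) (1 - ρ σ) ∩ lineTube s σ ⊆
                polynomialHull (⋃ n, radiusTorus r (f n) ε) := by
  have key : ∀ σ : ℝ, σ ∈ Set.Ioo (0 : ℝ) 1 → _ := fun σ hσ =>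
    exists_tori_of_small_radius (s := s) hσ.1 hσ.2 rfl rfl
  choose! ε' hε' H using key
  refine ⟨1, one_pos, fun σ => σ ^ 2 / 32 / 2, fun σ => {σ ^ 2 / 32}, ε',
    fun σ => 1 - σ ^ 2 / 32 / 2 / 2, ?_, fun η hη => ?_, fun σ hσ => ?_⟩
  · have : Continuous fun σ : ℝ => σ ^ 2 / 32 / 2 := by fun_prop
    simpa using (this.tendsto 0).mono_left nhdsWithin_le_nhds
  · refine ⟨min 1 η, by positivity, fun σ ⟨hσ, hσ'⟩ x hx => ?_⟩
    rw [lt_min_iff] at hσ'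
    rw [Finset.mem_singleton.1 hx]
    nlinarith
  · obtain ⟨hσ0, hσ1⟩ := hσ
    have h1 : 0 < σ ^ 2 := by positivity
    have h2 : σ ^ 2 < 1 := by nlinarith
    refine ⟨⟨by positivity, by linarith⟩, fun x hx => ?_, hε' σ ⟨hσ0, hσ1⟩,
      ⟨by linarith, by linarith⟩, fun ε hε => ?_⟩
    · rw [Finset.mem_singleton.1 hx]
      exact ⟨by positivity, by linarith⟩
    obtain ⟨J, _, ζ, hζ, hεt, hdisj, htube, hhull⟩ := H σ ⟨hσ0, hσ1⟩ ε hε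
    let e := (Fintype.equivFin J).symm
    have hU : ∀ T : J → Set C2, ⋃ n, T (e n) = ⋃ j, T j := fun T => e.surjective.iUnion_comp T
    refine ⟨Fintype.card J, fun n => lineFun (1 - σ ^ 2 / 32) (ζ (e n)),
      fun n => isUnitAffine_lineFun (hζ _) _, fun n => ?_, fun n => ?_, fun m n hmn => ?_,
      fun n => htube _, ?_, fun r hr => ?_⟩
    · exact isSolidTorus_torus_lineFun (hζ _) (by linarith) (by linarith [hε.1]) hεt
    · exact ⟨_, Finset.mem_singleton_self _, exists_image_torus_lineFun (hζ _) _ _⟩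
    · exact hdisj _ _ fun h => hmn (e.injective h)
    · rw [hU fun j => torus (lineFun (1 - σ ^ 2 / 32) (ζ j)) ε]
      -- The unit sphere is the case `r = 1`.
      exact hhull 1 ⟨by linarith, le_rfl⟩
    · rw [hU fun j => radiusTorus r (lineFun (1 - σ ^ 2 / 32) (ζ j)) ε]
      exact hhull r hr
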